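/- **Lemma 2.1 (uniqueness).** Let $\theta\in(0,\frac{\pi}{2})$ and $\alpha,\beta\in[0,\frac{\pi}{2}]$ with $(\alpha,\beta)\neq(0,\theta)$. Put $\lambda=\cot\frac{\theta}{2}$ and $$\mu=\frac{\pi\csc\theta}{K(\sin^2\theta)},\qquad K(m)=\int_0^{\pi/2}\frac{du}{\sqrt{1-m\sin^2u}},$$ $$\sigma=\cos\tfrac{\alpha+\beta}{2}+i\cos\tfrac{\alpha-\beta}{2},\qquad \delta=\sin\tfrac{\alpha-\beta}{2}+i\sin\tfrac{\alpha+\beta}{2}.$$ The standard example $M_{\theta,\alpha,\beta}$ is the minimal surface with Weierstrass data $$g(z,w)=\frac{\sigma z+\delta}{i(\overline\sigma-\overline\delta z)},\qquad dh=\mu\,\frac{dz}{w}$$ on the torus $\Sigma_\theta=\{(z,w)\in\overline{\mathbb C}^2: w^2=(z^2+\lambda^2)(z^2+\lambda^{-2})\}$; its ends are the points of $g^{-1}(\{0,\infty\})$. Its flux vector along a closed curve $\gamma\subset\Sigma_\theta\setminus g^{-1}(\{0,\infty\})$ is $$F_\gamma=\operatorname{Im}\int_\gamma\Phi\in\mathbb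 R^3,\qquad \Phi=\Big(\tfrac12\big(\tfrac1g-g\big),\ \tfrac i2\big(\tfrac1g+g\big),\ 1\Big)dh .$$ Let $U=\{(z,w)\in\Sigma_\theta: \lambda^{-1}<|z|<\lambda,\ \operatorname{Re}(w/z)>0\}$; the map $(z,w)\mapsto z$ sends $U$ biholomorphically onto the annulus $\lambda^{-1}<|z|<\lambda$. Let $\gamma_2$ denote any closed $C^1$ curve in $U\setminus g^{-1}(\{0,\infty\})$ such that $z$ has winding number $1$ about $0$ along it, and the functions $\sigma z+\delta$ and $\overline\sigma-\overline\delta z$ have winding numbers $1$ and $0$ about $0$ along it. (If $\alpha,\beta<\frac{\pi}{2}$, such a curve is the positively oriented circle $|z|=1$ in $U$. If $\alpha=\frac{\pi}{2}$ or $\beta=\frac{\pi}{2}$, the ends lie over this circle, and $\gamma_2$ is in the class obtained by continuity in $(\alpha,\beta)$, with the zero of $g$ inside and the pole of $g$ outside.) Then such curves $\gamma_2$ exist, and for every one of them $$F_{\gamma_2}=(0,0,2\pi)\quad\Longleftrightarrow\quad \alpha=\beta=0 .$$ -/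

import Mathlib

open Complex MeasureTheory

noncomputable section

namespace StdExample

/-- The branch parameter `λ(θ) = cot (θ / 2)`, which is `> 1` for `0 < θ < π / 2`. -/
def lam (θ : ℝ) : ℝ := Real.cot (θ / 2)

/-- The complete elliptic integral of the first kind, `K(m)`, for `0 < m < 1`. -/
def ellipticK (m : ℝ) : ℝ :=
  ∫ u in (0 : ℝ)..(Real.pi / 2), 1 / Real.sqrt (1 - m * Real.sin u ^ 2)

/-- The normalizing constant `μ(θ) = π csc θ / K(sin² θ)` of the height differential. -/
def mu (θ : ℝ) : ℝ := Real.pi / (Real.sin θ * ellipticK (Real.sin θ ^ 2))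

/-- The finite part of the torus `Σ_θ = {w² = (z² + λ²)(z² + λ⁻²)}`. -/
def curveSigma (θ : ℝ) : Set (ℂ × ℂ) :=
  {p | p.2 ^ 2 = (p.1 ^ 2 + (lam θ : ℂ) ^ 2) * (p.1 ^ 2 + ((lam θ : ℂ)⁻¹) ^ 2)}

/-- `σ = cos ((α + β) / 2) + i cos ((α - β) / 2)`. -/
def sig (α β : ℝ) : ℂ :=
  (Real.cos ((α + β) / 2) : ℂ) + I * (Real.cos ((α - β) / 2) : ℂ)

/-- `δ = sin ((α - β) / 2) + i sin ((α + β) / 2)`. -/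
def del (α β : ℝ) : ℂ :=
  (Real.sin ((α - β) / 2) : ℂ) + I * (Real.sin ((α + β) / 2) : ℂ)

/-- Numerator of the Gauss map; it vanishes exactly at the zeros of the Gauss map. -/
def gaussNum (α β : ℝ) (z : ℂ) : ℂ := sig α β * z + del α β

/-- `conj σ - (conj δ) z`; at finite `z` it vanishes exactly at the poles of the Gauss map. -/
def gaussDen (α β : ℝ) (z : ℂ) : ℂ :=
  (starRingEnd ℂ) (sig α β) - (starRingEnd ℂ) (del α β) * z

/-- The Gauss map `g(z, w) = (σ z + δ) / (i (conj σ - (conj δ) z))`. -/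
def gauss (α β : ℝ) (p : ℂ × ℂ) : ℂ := gaussNum α β p.1 / (I * gaussDen α β p.1)

/-- The coefficient of `dz` in the height differential `dh = μ dz / w`. -/
def dhCoeff (θ : ℝ) (p : ℂ × ℂ) : ℂ := (mu θ : ℂ) / p.2

/-- The coefficient of `dz` in the Weierstrass form
`Φ = ((1/g - g) / 2, (i/2) (1/g + g), 1) dh`. -/
def weierstrass (θ α β : ℝ) (p : ℂ × ℂ) : Fin 3 → ℂ :=
  ![(1 / 2) * (1 / gauss α β p - gauss α β p) * dhCoeff θ p,
    (I / 2) * (1 / gauss α β p + gauss α β p) * dhCoeff θ p,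
    dhCoeff θ p]

/-- `∫_γ Φ` along a closed curve `γ = (z, w)` parametrized on `[0, 2π]`. -/
def weierstrassIntegral (θ α β : ℝ) (γ : ℝ → ℂ × ℂ) (k : Fin 3) : ℂ :=
  ∫ t in (0 : ℝ)..(2 * Real.pi),
    weierstrass θ α β (γ t) k * deriv (fun s => (γ s).1) t

/-- The flux vector `F_γ = Im ∫_γ Φ`. -/
def flux (θ α β : ℝ) (γ : ℝ → ℂ × ℂ) : Fin 3 → ℝ :=
  fun k => (weierstrassIntegral θ α β γ k).im

/-- Winding number about `0` of a `2π`-periodic curve `f` that avoids `0`. -/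
def winding (f : ℝ → ℂ) : ℂ :=
  (2 * (Real.pi : ℂ) * I)⁻¹ * ∫ t in (0 : ℝ)..(2 * Real.pi), deriv f t / f t

/-- The part over the annulus `λ⁻¹ < |z| < λ` of the first sheet of the double cover
`(z, w) ↦ z`. The sheets are cut along the two segments of `i ℝ ∪ {∞}` that join branch values
(`|z| ≤ λ⁻¹` and `|z| ≥ λ`). Off the cuts `(w / z)² = z² + z⁻² + λ² + λ⁻²` is never in
`(-∞, 0]`, so the sheets are told apart by the sign of `Re (w / z)`; the first one contains the
point over `z = 1` with `w > 0`. -/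
def firstSheet (θ : ℝ) : Set (ℂ × ℂ) :=
  {p | p ∈ curveSigma θ ∧ (lam θ)⁻¹ < ‖p.1‖ ∧ ‖p.1‖ < lam θ ∧ 0 < (p.2 / p.1).re}

/-- `γ` is a closed `C¹` curve in the first sheet, off the ends of `M_{θ,α,β}`, that represents
the homology class of `γ₂` in the punctured torus. For `α, β < π / 2` this class is that of the
unit circle `|z| = 1` of the first sheet, positively oriented; there the zeros of `g` have
`|z| < 1` and its poles have `|z| > 1`. When `α = π / 2` or `β = π / 2` the ends are on `|z| = 1`,
and the class is the one obtained by continuity: the curve is pushed off the ends so that the zero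
of `g` stays inside and the pole stays outside. In the annular first sheet the class is given by
the winding numbers about `z = 0`, about the zero and about the pole of `g`. (The last two are
stated through `σ z + δ` and `conj σ - (conj δ) z`, which allows the pole to be `z = ∞`.) -/
structure IsGammaTwo (θ α β : ℝ) (γ : ℝ → ℂ × ℂ) : Prop where
  smooth : ContDiff ℝ 1 γ
  closed : Function.Periodic γ (2 * Real.pi)
  mem_sheet : ∀ t, γ t ∈ firstSheet θ
  avoids_zeros : ∀ t, gaussNum α β (γ t).1 ≠ 0
  avoids_poles : ∀ t, gaussDen α β (γ t).1 ≠ 0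
  winding_origin : winding (fun t => (γ t).1) = 1
  winding_zero : winding (fun t => gaussNum α β (γ t).1) = 1
  winding_pole : winding (fun t => gaussDen α β (γ t).1) = 0

end StdExample

end

/-!
Put `b = δ / σ`. Up to constants `g = (z + b) / (1 - conj b z)`, and `|b| ≤ 1`, with `b = 0` exactly
for `α = β = 0`. On the first sheet `w` is a function of `z`, namely `w = z * sheetRoot L z` with
`L = cot (θ / 2)`, so every period is the integral of a function of `z` along a loop in the
annulus `L⁻¹ < |z| < L`.

Let `A` be the period of `dh / g`. The antipodal map `τ : z ↦ -1 / conj z` satisfies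
`g ∘ τ = -1 / conj g` and `τ^* dh = -conj dh`, exchanges the zero and the pole of `g`, and keeps the
homology class of the loop. Hence the period of `g dh` is `conj A` (`integral_pole_eq_conj`). The
vertical flux is `2π` by the choice of `μ` (`integral_height`), so the flux is
`(Im A, Re A, 2π)` (`exists_flux_eq`), and the claim is that `A = 0` only for `b = 0`.

The period `A` depends only on the winding numbers about `0` and `-b`, by Cauchy's theorem in
an annulus (`IsAnnulusLoop.integral_div_eq`). For `|b| < 1` it can be computed on the unit circle,
where `z / w = W` is real, positive and invariant under `z ↦ -z`: up to a nonzero constant factor,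
`b A` is the integral of `W` times the kernel `(b - |b|² z) / (z + b)`. The symmetrization of this
kernel under `z ↦ -z` has nonpositive real part (`re_kernel_add_kernel_neg_nonpos`), and the kernel
has mean `-|b|²`. Thus the real part of that integral is at most `-2π |b|² min W` (`re_integral_kernel_le`), a bound
that survives the limit `|b| → 1` (`period_ne_zero`). For `b = 0` the integrand is odd under
`z ↦ -z` and `A = 0` (`period_eq_zero`).
-/

/-! ### Loops in an annulus -/

/-- A closed `C¹` curve, parametrized on `[0, 2π]`, that runs in the annulus `a < |z| < R` and has
winding number `1` about `0`. -/
structure IsAnnulusLoop (a R : ℝ) (z : ℝ → ℂ) : Prop where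
  smooth : ContDiff ℝ 1 z
  closed : z (2 * Real.pi) = z 0
  mem : ∀ t, a < ‖z t‖ ∧ ‖z t‖ < R
  winding_eq : StdExample.winding z = 1

lemma integral_logDeriv_of_winding {f : ℝ → ℂ} {n : ℂ} (h : StdExample.winding f = n) :
    ∫ t in (0 : ℝ)..(2 * Real.pi), deriv f t / f t = 2 * (Real.pi : ℂ) * I * n := by
  rw [← h, StdExample.winding, mul_inv_cancel_left₀ two_pi_I_ne_zero]

lemma winding_eq_of_integral {f : ℝ → ℂ} {n : ℂ}
    (h : ∫ t in (0 : ℝ)..(2 * Real.pi), deriv f t / f t = 2 * (Real.pi : ℂ) * I * n) :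
    StdExample.winding f = n := by
  rw [StdExample.winding, h, inv_mul_cancel_left₀ two_pi_I_ne_zero]

lemma exists_log_lift {z : ℝ → ℂ} (hz : ContDiff ℝ 1 z) (h0 : ∀ t, z t ≠ 0) :
    ∃ ζ : ℝ → ℂ, ∀ t, HasDerivAt ζ (deriv z t / z t) t ∧ exp (ζ t) = z t := by
  have hc : Continuous fun t => deriv z t / z t :=
    (hz.continuous_deriv le_rfl).div hz.continuous h0
  have hd : ∀ t, HasDerivAt (fun t => log (z 0) + ∫ x in (0 : ℝ)..t, deriv z x / z x)
      (deriv z t / z t) t := fun t =>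
    (intervalIntegral.integral_hasDerivAt_right (hc.intervalIntegrable _ _)
      (hc.stronglyMeasurableAtFilter _ _) hc.continuousAt).const_add _
  refine ⟨_, fun t => ⟨hd t, ?_⟩⟩
  set ζ := fun t => log (z 0) + ∫ x in (0 : ℝ)..t, deriv z x / z x with hζ
  have hq : ∀ t, HasDerivAt (fun t => exp (ζ t) / z t) 0 t := by
    intro t
    have h1 := (hz.differentiable (by norm_num) t).hasDerivAt
    refine ((hd t).cexp.div h1 (h0 t)).congr_deriv ?_
    have := h0 t
    field_simp
    ring
  have := is_const_of_deriv_eq_zero (fun t => (hq t).differentiableAt) (fun t => (hq t).deriv) t 0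
  have h00 : exp (ζ 0) / z 0 = 1 := by
    simp [hζ, exp_log (h0 0), div_self (h0 0)]
  rw [h00, div_eq_one_iff_eq (h0 t)] at this
  exact this

/-- Cauchy's theorem in an annulus. In the coordinate `ζ = log z` the annulus becomes a convex
strip, where `G dz` has a primitive `P`; a loop that winds once around `0` lifts to a path from
some `ζ` to `ζ + 2πi`, and `P (ζ + 2πi) - P ζ` does not depend on `ζ`. -/
theorem IsAnnulusLoop.integral_eq {a R : ℝ} (ha : 0 < a) {G : ℂ → ℂ}
    (hG : DifferentiableOn ℂ G {z | a < ‖z‖ ∧ ‖z‖ < R}) {z₁ z₂ : ℝ → ℂ}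
    (h₁ : IsAnnulusLoop a R z₁) (h₂ : IsAnnulusLoop a R z₂) :
    ∫ t in (0 : ℝ)..(2 * Real.pi), G (z₁ t) * deriv z₁ t =
      ∫ t in (0 : ℝ)..(2 * Real.pi), G (z₂ t) * deriv z₂ t := by
  set S : Set ℂ := re ⁻¹' Set.Ioo (Real.log a) (Real.log R) with hS
  have hSconv : Convex ℝ S := (convex_Ioo _ _).linear_preimage reLm
  have hSopen : IsOpen S := isOpen_Ioo.preimage continuous_re
  have hR : 0 < R := ha.trans ((h₁.mem 0).1.trans (h₁.mem 0).2)
  have hexp : ∀ ζ, ζ ∈ S ↔ a < ‖exp ζ‖ ∧ ‖exp ζ‖ < R := by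
    intro ζ
    rw [norm_exp, hS, Set.mem_preimage, Set.mem_Ioo, Real.log_lt_iff_lt_exp ha,
      Real.lt_log_iff_exp_lt hR]
  have hE : DifferentiableOn ℂ (fun ζ => G (exp ζ) * exp ζ) S :=
    (hG.comp differentiable_exp.differentiableOn fun ζ hζ => (hexp ζ).1 hζ).mul
      differentiable_exp.differentiableOn
  obtain ⟨P, hP⟩ := hSconv.exists_forall_hasDerivWithinAt hE
  replace hP : ∀ ζ ∈ S, HasDerivAt P (G (exp ζ) * exp ζ) ζ := fun ζ hζ =>
    (hP ζ hζ).hasDerivAt (hSopen.mem_nhds hζ)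
  have hshift : ∀ ζ ∈ S, ζ + 2 * Real.pi * I ∈ S := by
    intro ζ hζ
    rw [hexp] at hζ ⊢
    simpa [exp_add, exp_two_pi_mul_I] using hζ
  have hD : ∀ ζ ∈ S, HasDerivAt (fun ζ => P (ζ + 2 * Real.pi * I) - P ζ) 0 ζ := by
    intro ζ hζ
    have h := ((hP _ (hshift ζ hζ)).comp_add_const ζ (2 * Real.pi * I)).sub (hP ζ hζ)
    refine h.congr_deriv ?_
    simp [exp_add, exp_two_pi_mul_I]
  have hconst : ∀ ζ ∈ S, ∀ ξ ∈ S,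
      P (ζ + 2 * Real.pi * I) - P ζ = P (ξ + 2 * Real.pi * I) - P ξ := fun ζ hζ ξ hξ =>
    hSopen.is_const_of_deriv_eq_zero hSconv.isPreconnected
      (fun x hx => (hD x hx).differentiableAt.differentiableWithinAt)
      (fun x hx => (hD x hx).deriv) hζ hξ
  have key : ∀ z : ℝ → ℂ, IsAnnulusLoop a R z → ∃ ζ ∈ S,
      ∫ t in (0 : ℝ)..(2 * Real.pi), G (z t) * deriv z t =
        P (ζ + 2 * Real.pi * I) - P ζ := by
    intro z hz
    have h0 : ∀ t, z t ≠ 0 := fun t => norm_pos_iff.1 (ha.trans (hz.mem t).1)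
    obtain ⟨ζ, hζ⟩ := exists_log_lift hz.smooth h0
    have hmem : ∀ t, ζ t ∈ S := fun t => (hexp _).2 (by rw [(hζ t).2]; exact hz.mem t)
    have hdc := hz.smooth.continuous_deriv le_rfl
    have hdiff : ζ (2 * Real.pi) - ζ 0 = 2 * Real.pi * I := by
      rw [← intervalIntegral.integral_eq_sub_of_hasDerivAt (fun t _ => (hζ t).1)
        ((hdc.div hz.smooth.continuous h0).intervalIntegrable _ _),
        integral_logDeriv_of_winding hz.winding_eq, mul_one]
    refine ⟨ζ 0, hmem 0, ?_⟩
    have hGz : Continuous fun t => G (z t) := by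
      refine hG.continuousOn.comp_continuous hz.smooth.continuous fun t => hz.mem t
    have hder : ∀ t, HasDerivAt (fun t => P (ζ t)) (G (z t) * deriv z t) t := by
      intro t
      refine ((hP _ (hmem t)).comp t (hζ t).1).congr_deriv ?_
      rw [(hζ t).2, mul_assoc, mul_div_cancel₀ _ (h0 t)]
    rw [intervalIntegral.integral_eq_sub_of_hasDerivAt (fun t _ => hder t)
      ((hGz.mul hdc).intervalIntegrable _ _), ← hdiff, add_sub_cancel]
  obtain ⟨ζ, hζ, e₁⟩ := key z₁ h₁
  obtain ⟨ξ, hξ, e₂⟩ := key z₂ h₂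
  rw [e₁, e₂, hconst ζ hζ ξ hξ]

/-- Residue theorem for one simple pole `-b`, which may lie in the annulus or not: the
integral of `N (z) / (z + b)` is the same along any two loops that wind once around `0`
and once around `-b`. -/
theorem IsAnnulusLoop.integral_div_eq {a R : ℝ} (ha : 0 < a) {N : ℂ → ℂ} {b : ℂ}
    (hN : DifferentiableOn ℂ N {z | a < ‖z‖ ∧ ‖z‖ < R}) {z₁ z₂ : ℝ → ℂ}
    (h₁ : IsAnnulusLoop a R z₁) (h₂ : IsAnnulusLoop a R z₂)
    (hb₁ : ∀ t, z₁ t + b ≠ 0) (hb₂ : ∀ t, z₂ t + b ≠ 0)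
    (hw₁ : StdExample.winding (fun t => z₁ t + b) = 1)
    (hw₂ : StdExample.winding (fun t => z₂ t + b) = 1) :
    ∫ t in (0 : ℝ)..(2 * Real.pi), N (z₁ t) / (z₁ t + b) * deriv z₁ t =
      ∫ t in (0 : ℝ)..(2 * Real.pi), N (z₂ t) / (z₂ t + b) * deriv z₂ t := by
  have hopen : IsOpen {z : ℂ | a < ‖z‖ ∧ ‖z‖ < R} :=
    (isOpen_lt continuous_const continuous_norm).inter (isOpen_lt continuous_norm continuous_const)
  by_cases hb : a < ‖-b‖ ∧ ‖-b‖ < R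
  · have hdN : DifferentiableOn ℂ (dslope N (-b)) {z | a < ‖z‖ ∧ ‖z‖ < R} :=
      (differentiableOn_dslope (hopen.mem_nhds hb)).2 hN
    have key : ∀ z : ℝ → ℂ, IsAnnulusLoop a R z → (∀ t, z t + b ≠ 0) →
        StdExample.winding (fun t => z t + b) = 1 →
        ∫ t in (0 : ℝ)..(2 * Real.pi), N (z t) / (z t + b) * deriv z t =
          (∫ t in (0 : ℝ)..(2 * Real.pi), dslope N (-b) (z t) * deriv z t) +
            N (-b) * (2 * Real.pi * I) := by
      intro z hz hzb hw
      have hdc := hz.smooth.continuous_deriv le_rfl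
      have hc : Continuous fun t => dslope N (-b) (z t) :=
        hdN.continuousOn.comp_continuous hz.smooth.continuous fun t => hz.mem t
      have hw' := integral_logDeriv_of_winding hw
      simp only [deriv_add_const, mul_one] at hw'
      have hc1 : Continuous fun t => dslope N (-b) (z t) * deriv z t := hc.mul hdc
      have hc2 : Continuous fun t => N (-b) * (deriv z t / (z t + b)) :=
        continuous_const.mul (hdc.div (hz.smooth.continuous.add continuous_const) hzb)
      rw [← hw', ← intervalIntegral.integral_const_mul, ← intervalIntegral.integral_add
        (hc1.intervalIntegrable _ _) (hc2.intervalIntegrable _ _)]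
      refine intervalIntegral.integral_congr fun t _ => ?_
      have hne : z t ≠ -b := fun h => hzb t (by rw [h, neg_add_cancel])
      have hzb' := hzb t
      simp only [dslope_of_ne _ hne, slope_def_field, sub_neg_eq_add]
      field_simp
      ring
    rw [key z₁ h₁ hb₁ hw₁, key z₂ h₂ hb₂ hw₂, h₁.integral_eq ha hdN h₂]
  · refine h₁.integral_eq (G := fun z => N z / (z + b)) ha (hN.div (by fun_prop) ?_) h₂
    intro z hz h
    exact hb (by rwa [eq_neg_of_add_eq_zero_left h] at hz)

lemma winding_circleMap {c : ℂ} {r : ℝ} (h : ‖c‖ < r) :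
    StdExample.winding (circleMap c r) = 1 := by
  apply winding_eq_of_integral
  have := circleIntegral.integral_sub_inv_of_mem_ball (c := c) (w := 0) (R := r) (by simpa using h)
  rw [mul_one, ← this, circleIntegral]
  simp [div_eq_mul_inv]

lemma isAnnulusLoop_circleMap {a R r : ℝ} {c : ℂ} (h1 : a < r - ‖c‖) (h2 : r + ‖c‖ < R)
    (ha : 0 < a) : IsAnnulusLoop a R (circleMap c r) where
  smooth := contDiff_circleMap c r
  closed := by simp [circleMap]
  mem t := by
    have hr : 0 < r := by linarith [norm_nonneg c]
    have e : ‖circleMap c r t - c‖ = r := by simp [abs_of_pos hr]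
    have i1 := norm_sub_norm_le (circleMap c r t - c) (-c)
    have i2 := norm_sub_norm_le (circleMap c r t) c
    simp only [sub_neg_eq_add, sub_add_cancel, norm_neg] at i1
    constructor <;> linarith
  winding_eq := winding_circleMap (by linarith)

/-! ### The branch of `w / z` on the first sheet -/

lemma sqrt_mul_self_eq (x : ℂ) : sqrt x ^ 2 = x := by
  exact_mod_cast cpow_nat_inv_pow x two_ne_zero

lemma abs_im_sqrt_lt_re_sqrt {x : ℂ} (hx : 0 < x.re) : |(sqrt x).im| < (sqrt x).re := by
  have hre : 0 < (sqrt x).re := by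
    rw [Complex.sqrt, cpow_inv_two_re]
    exact Real.sqrt_pos.2 (by linarith [norm_nonneg x])
  have h := congrArg re (sqrt_mul_self_eq x)
  rw [sq, mul_re] at h
  exact abs_lt_of_sq_lt_sq (by nlinarith) hre.le

lemma sqrt_conj_of_re_pos {x : ℂ} (hx : 0 < x.re) :
    sqrt ((starRingEnd ℂ) x) = (starRingEnd ℂ) (sqrt x) := by
  have : x.arg ≠ Real.pi := by
    intro h
    have := (arg_eq_pi_iff.1 h).1
    linarith
  rw [Complex.sqrt, Complex.sqrt, conj_cpow _ _ this, map_inv₀, map_ofNat]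

lemma one_add_re_pos {x : ℂ} (hx : ‖x‖ < 1) : 0 < (1 + x).re := by
  have := neg_le_of_abs_le (abs_re_le_norm x)
  simp only [add_re, one_re]
  linarith

/-- The branch `w / z = √(z² + z⁻² + L² + L⁻²)` on the first sheet, written through the
factorization `z² + z⁻² + L² + L⁻² = L² (1 + z² / L²) (1 + 1 / (L² z²))`: in the annulus
`L⁻¹ < |z| < L` both factors have positive real part, so principal roots can be used. -/
noncomputable def sheetRoot (L : ℝ) (z : ℂ) : ℂ :=
  L * sqrt (1 + z ^ 2 / L ^ 2) * sqrt (1 + 1 / (L ^ 2 * z ^ 2))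

section
variable {L : ℝ} {z : ℂ}

lemma ne_zero_of_mem_annulus (hL : 1 < L) (hz : L⁻¹ < ‖z‖) : z ≠ 0 :=
  norm_pos_iff.1 ((inv_pos.2 (zero_lt_one.trans hL)).trans hz)

lemma re_factor_pos (hL : 1 < L) (hz : ‖z‖ < L) : 0 < (1 + z ^ 2 / L ^ 2 : ℂ).re := by
  apply one_add_re_pos
  have h0 : 0 < L := by linarith
  rw [← div_pow, norm_pow, norm_div, norm_real, Real.norm_of_nonneg h0.le]
  exact pow_lt_one₀ (by positivity) ((div_lt_one h0).2 hz) two_ne_zero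

lemma re_factor_inv_pos (hL : 1 < L) (hz : L⁻¹ < ‖z‖) :
    0 < (1 + 1 / (L ^ 2 * z ^ 2) : ℂ).re := by
  have h0 : 0 < L := by linarith
  have h := re_factor_pos (z := z⁻¹) hL
    (by rw [norm_inv]; exact inv_lt_of_inv_lt₀ h0 hz)
  have e : (1 + 1 / (L ^ 2 * z ^ 2) : ℂ) = 1 + z⁻¹ ^ 2 / L ^ 2 := by
    rw [inv_pow, one_div, mul_inv, div_eq_mul_inv, mul_comm]
  rwa [e]

lemma sheetRoot_sq (hL : 1 < L) (hz : L⁻¹ < ‖z‖) :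
    (z * sheetRoot L z) ^ 2 = (z ^ 2 + (L : ℂ) ^ 2) * (z ^ 2 + ((L : ℂ)⁻¹) ^ 2) := by
  have hz0 := ne_zero_of_mem_annulus hL hz
  have hL0 : (L : ℂ) ≠ 0 := by exact_mod_cast (by linarith : L ≠ 0)
  rw [sheetRoot, mul_pow, mul_pow, mul_pow, sqrt_mul_self_eq, sqrt_mul_self_eq]
  field_simp
  ring

lemma sheetRoot_re_pos (hL : 1 < L) (hz : L⁻¹ < ‖z‖) (hz' : ‖z‖ < L) :
    0 < (sheetRoot L z).re := by
  have h1 := abs_im_sqrt_lt_re_sqrt (re_factor_pos hL hz')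
  have h2 := abs_im_sqrt_lt_re_sqrt (re_factor_inv_pos hL hz)
  rw [sheetRoot, mul_assoc, re_ofReal_mul, mul_re]
  have h3 := mul_lt_mul'' h1 h2 (abs_nonneg _) (abs_nonneg _)
  rw [← abs_mul] at h3
  exact mul_pos (by linarith) (sub_pos.2 ((le_abs_self _).trans_lt h3))

lemma sheetRoot_ne_zero (hL : 1 < L) (hz : L⁻¹ < ‖z‖) (hz' : ‖z‖ < L) : sheetRoot L z ≠ 0 := by
  intro h
  have := sheetRoot_re_pos hL hz hz'
  simp [h] at this

lemma sheetRoot_contDiffAt (hL : 1 < L) (hz : L⁻¹ < ‖z‖) (hz' : ‖z‖ < L) :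
    ContDiffAt ℂ 1 (sheetRoot L) z := by
  have hz0 := ne_zero_of_mem_annulus hL hz
  have hL0 : (L : ℂ) ≠ 0 := by exact_mod_cast (by linarith : L ≠ 0)
  have hs : ∀ x : ℂ, 0 < x.re → ContDiffAt ℂ 1 sqrt x := by
    intro x hx
    have hd : DifferentiableOn ℂ sqrt slitPlane := differentiableOn_sqrt
    exact (hd.contDiffOn isOpen_slitPlane).contDiffAt
      (isOpen_slitPlane.mem_nhds (Or.inl hx))
  unfold sheetRoot
  refine (contDiffAt_const.mul ?_).mul ?_
  · exact (hs _ (re_factor_pos hL hz')).comp z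
      (f := fun z : ℂ => 1 + z ^ 2 / (L : ℂ) ^ 2) (by fun_prop)
  · refine (hs _ (re_factor_inv_pos hL hz)).comp z
      (f := fun z : ℂ => 1 + 1 / ((L : ℂ) ^ 2 * z ^ 2)) ?_
    exact contDiffAt_const.add (contDiffAt_const.div (by fun_prop) (by positivity))

lemma sheetRoot_differentiableOn (hL : 1 < L) :
    DifferentiableOn ℂ (sheetRoot L) {z | L⁻¹ < ‖z‖ ∧ ‖z‖ < L} := fun _ hz =>
  ((sheetRoot_contDiffAt hL hz.1 hz.2).differentiableAt one_ne_zero).differentiableWithinAt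

/-- The antiholomorphic involution `z ↦ -1 / conj z` of the annulus conjugates the branch. -/
lemma sheetRoot_neg_inv_conj (hL : 1 < L) (hz : L⁻¹ < ‖z‖) (hz' : ‖z‖ < L) :
    sheetRoot L (-((starRingEnd ℂ) z)⁻¹) = (starRingEnd ℂ) (sheetRoot L z) := by
  have hz0 := ne_zero_of_mem_annulus hL hz
  have hc0 : (starRingEnd ℂ) z ≠ 0 := by simpa using hz0
  have hL0 : (L : ℂ) ≠ 0 := by exact_mod_cast (by linarith : L ≠ 0)
  rw [sheetRoot, sheetRoot, map_mul, map_mul, ← sqrt_conj_of_re_pos (re_factor_pos hL hz'),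
    ← sqrt_conj_of_re_pos (re_factor_inv_pos hL hz), mul_assoc, mul_assoc, mul_comm (sqrt _)]
  simp only [map_add, map_div₀, map_mul, map_pow, map_one, conj_ofReal]
  congr 4 <;> field_simp

lemma sheetRoot_of_norm_eq_one (hL : 1 < L) (hz : ‖z‖ = 1) :
    sheetRoot L z = ((L * ‖1 + z ^ 2 / (L : ℂ) ^ 2‖ : ℝ) : ℂ) := by
  have hzL : ‖z‖ < L := by rw [hz]; exact hL
  have hc : (starRingEnd ℂ) (1 + z ^ 2 / (L : ℂ) ^ 2) = 1 + 1 / (L ^ 2 * z ^ 2) := by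
    have hz0 : z ≠ 0 := norm_pos_iff.1 (by rw [hz]; norm_num)
    have hzz : (starRingEnd ℂ) z = z⁻¹ := by
      rw [inv_def, normSq_eq_norm_sq, hz]; simp
    simp only [map_add, map_div₀, map_pow, map_one, conj_ofReal, hzz]
    rw [inv_pow, one_div, mul_inv, div_eq_mul_inv, mul_comm]
  rw [sheetRoot, ← hc, sqrt_conj_of_re_pos (re_factor_pos hL hzL), mul_assoc, mul_conj,
    normSq_eq_norm_sq, ← norm_pow, sqrt_mul_self_eq, ofReal_mul]

/-- On the first sheet `w` is determined by `z`. -/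
lemma eq_mul_sheetRoot_of_mem_firstSheet {θ : ℝ} (hL : 1 < StdExample.lam θ) {p : ℂ × ℂ}
    (hp : p ∈ StdExample.firstSheet θ) : p.2 = p.1 * sheetRoot (StdExample.lam θ) p.1 := by
  obtain ⟨hc, h1, h2, h3⟩ := hp
  have hz0 := ne_zero_of_mem_annulus hL h1
  have hsq : p.2 ^ 2 = (p.1 * sheetRoot (StdExample.lam θ) p.1) ^ 2 := by
    rw [sheetRoot_sq hL h1]; exact hc
  rcases sq_eq_sq_iff_eq_or_eq_neg.1 hsq with h | h
  · exact h
  · have := sheetRoot_re_pos hL h1 h2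
    rw [h, neg_div, mul_div_cancel_left₀ _ hz0, neg_re] at h3
    linarith

lemma mk_mul_sheetRoot_mem_firstSheet {θ : ℝ} (hL : 1 < StdExample.lam θ)
    (h1 : (StdExample.lam θ)⁻¹ < ‖z‖) (h2 : ‖z‖ < StdExample.lam θ) :
    (z, z * sheetRoot (StdExample.lam θ) z) ∈ StdExample.firstSheet θ := by
  refine ⟨sheetRoot_sq hL h1, h1, h2, ?_⟩
  rw [mul_div_cancel_left₀ _ (ne_zero_of_mem_annulus hL h1)]
  exact sheetRoot_re_pos hL h1 h2

end

/-! ### A kernel on the unit circle with a sign -/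

/-- The symmetrization of the kernel `(b - |b|² z) / (z + b)` under `z ↦ -z` has nonpositive real
part on the unit circle. -/
lemma re_kernel_add_kernel_neg_nonpos {b z : ℂ} (hb : ‖b‖ < 1) (hz : ‖z‖ = 1) :
    ((b - (‖b‖ : ℂ) ^ 2 * z) / (z + b)).re + ((b - (‖b‖ : ℂ) ^ 2 * -z) / (-z + b)).re ≤ 0 := by
  have h1 : z + b ≠ 0 := by
    intro h
    rw [eq_neg_of_add_eq_zero_left h, norm_neg] at hz
    linarith
  have h2 : -z + b ≠ 0 := by
    intro h
    rw [neg_add_eq_zero.1 h] at hz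
    linarith
  set ρ : ℝ := ‖b‖ ^ 2 with hρ
  have hρ1 : ρ ≤ 1 := pow_le_one₀ (norm_nonneg b) hb.le
  have hsum : (b - (‖b‖ : ℂ) ^ 2 * z) / (z + b) + (b - (‖b‖ : ℂ) ^ 2 * -z) / (-z + b) =
      2 * (b ^ 2 + ρ * z ^ 2) / (b ^ 2 - z ^ 2) := by
    have h3 : b ^ 2 - z ^ 2 ≠ 0 := by
      have : b ^ 2 - z ^ 2 = (z + b) * (-z + b) := by ring
      rw [this]; exact mul_ne_zero h1 h2
    rw [hρ]
    push_cast
    field_simp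
    ring
  rw [← add_re, hsum, div_eq_mul_inv, inv_def, ← mul_assoc, re_mul_ofReal]
  refine mul_nonpos_of_nonpos_of_nonneg ?_ (inv_nonneg.2 (normSq_nonneg _))
  have e1 : b.re ^ 2 + b.im ^ 2 = ρ := by rw [hρ, ← normSq_eq_norm_sq, normSq_apply]; ring
  have e2 : z.re ^ 2 + z.im ^ 2 = 1 := by
    have := normSq_eq_norm_sq z
    rw [normSq_apply, hz] at this
    linarith
  -- `(b² + ρ z²) · conj (b² - z²)` has real part `-(1 - ρ) (ρ + Re (b² conj z²))`,
  -- and `|b² conj z²| = ρ`.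
  have e3 : (2 * (b ^ 2 + ρ * z ^ 2) * (starRingEnd ℂ) (b ^ 2 - z ^ 2)).re =
      -(2 * (1 - ρ) * (ρ + (b ^ 2 * (starRingEnd ℂ) (z ^ 2)).re)) := by
    have f1 : (b ^ 2 * (starRingEnd ℂ) (b ^ 2)) = ((ρ ^ 2 : ℝ) : ℂ) := by
      rw [mul_conj, normSq_eq_norm_sq, norm_pow, hρ]
    have f2 : (z ^ 2 * (starRingEnd ℂ) (z ^ 2)) = ((1 : ℝ) : ℂ) := by
      rw [mul_conj, normSq_eq_norm_sq, norm_pow, hz]; norm_num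
    have f3 : (z ^ 2 * (starRingEnd ℂ) (b ^ 2)).re = (b ^ 2 * (starRingEnd ℂ) (z ^ 2)).re := by
      rw [← conj_re, map_mul, conj_conj, mul_comm]
    have : 2 * (b ^ 2 + ρ * z ^ 2) * (starRingEnd ℂ) (b ^ 2 - z ^ 2) =
        ((2 : ℝ) : ℂ) * ((b ^ 2 * (starRingEnd ℂ) (b ^ 2)) - b ^ 2 * (starRingEnd ℂ) (z ^ 2) +
          (ρ : ℂ) * (z ^ 2 * (starRingEnd ℂ) (b ^ 2)) -
          (ρ : ℂ) * (z ^ 2 * (starRingEnd ℂ) (z ^ 2))) := by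
      rw [map_sub]; push_cast; ring
    rw [this, f1, f2, re_ofReal_mul, sub_re, add_re, sub_re, re_ofReal_mul, f3, re_ofReal_mul,
      ofReal_re, ofReal_re]
    ring
  rw [e3]
  have e4 : |(b ^ 2 * (starRingEnd ℂ) (z ^ 2)).re| ≤ ρ := by
    refine (abs_re_le_norm _).trans_eq ?_
    rw [norm_mul, norm_pow, norm_conj, norm_pow, hz, hρ]; norm_num
  have := neg_le_of_abs_le e4
  have : 0 ≤ 2 * (1 - ρ) * (ρ + (b ^ 2 * (starRingEnd ℂ) (z ^ 2)).re) :=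
    mul_nonneg (by linarith) (by linarith)
  linarith

lemma circleMap_add_ne_zero {b : ℂ} {r : ℝ} (hb : ‖b‖ < r) (t : ℝ) :
    circleMap 0 r t + b ≠ 0 := by
  intro h
  have := congrArg norm (eq_neg_of_add_eq_zero_left h)
  rw [norm_circleMap_zero, norm_neg] at this
  linarith [le_abs_self r]

lemma circleMap_zero_one_add_pi (t : ℝ) : circleMap 0 1 (t + Real.pi) = -circleMap 0 1 t := by
  simp [circleMap, add_mul, exp_add]

lemma continuous_kernel {b : ℂ} (hb : ‖b‖ < 1) : Continuous fun t : ℝ =>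
    (b - (‖b‖ : ℂ) ^ 2 * circleMap 0 1 t) / (circleMap 0 1 t + b) :=
  Continuous.div (by fun_prop) (by fun_prop) (circleMap_add_ne_zero hb)

lemma integral_kernel {b : ℂ} (hb : ‖b‖ < 1) :
    ∫ t in (0 : ℝ)..(2 * Real.pi),
      (b - (‖b‖ : ℂ) ^ 2 * circleMap 0 1 t) / (circleMap 0 1 t + b) =
      -(2 * Real.pi * (‖b‖ : ℂ) ^ 2) := by
  have hne := circleMap_add_ne_zero hb
  have h0 : ∀ t, circleMap 0 1 t ≠ 0 := fun t => circleMap_ne_center one_ne_zero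
  have i1 := integral_logDeriv_of_winding (winding_circleMap (c := 0) (r := 1) (by simp))
  have i2 := integral_logDeriv_of_winding (winding_circleMap (c := b) (r := 1) hb)
  -- On the unit circle the kernel is a combination of the logarithmic derivatives of `z`
  -- and of `z + b`.
  have e : ∀ t : ℝ, (b - (‖b‖ : ℂ) ^ 2 * circleMap 0 1 t) / (circleMap 0 1 t + b) =
      -I * (deriv (circleMap 0 1) t / circleMap 0 1 t) -
        (-I * (1 + (‖b‖ : ℂ) ^ 2)) * (deriv (circleMap b 1) t / circleMap b 1 t) := by
    intro t
    have hb' : circleMap b 1 t = circleMap 0 1 t + b := by simp [circleMap, add_comm]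
    have := hne t
    have := h0 t
    rw [deriv_circleMap, deriv_circleMap, hb']
    field_simp
    linear_combination (b - (‖b‖ : ℂ) ^ 2 * circleMap 0 1 t) * I_sq
  have c1 : Continuous fun t => -I * (deriv (circleMap 0 1) t / circleMap 0 1 t) := by
    simp only [deriv_circleMap]
    exact continuous_const.mul (Continuous.div (by fun_prop) (by fun_prop) h0)
  have c2 : Continuous fun t => (-I * (1 + (‖b‖ : ℂ) ^ 2)) *
      (deriv (circleMap b 1) t / circleMap b 1 t) := by
    simp only [deriv_circleMap]
    refine continuous_const.mul (Continuous.div (by fun_prop) (by fun_prop) fun t => ?_)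
    have hb' : circleMap b 1 t = circleMap 0 1 t + b := by simp [circleMap, add_comm]
    rw [hb']; exact hne t
  simp only [e]
  rw [intervalIntegral.integral_sub (c1.intervalIntegrable _ _) (c2.intervalIntegrable _ _),
    intervalIntegral.integral_const_mul, intervalIntegral.integral_const_mul, i1, i2]
  linear_combination (2 * Real.pi * (‖b‖ : ℂ) ^ 2) * I_sq

lemma integral_comp_add_pi {E : Type*} [NormedAddCommGroup E] [NormedSpace ℝ E] {f : ℝ → E}
    (hf : Function.Periodic f (2 * Real.pi)) :
    ∫ t in (0 : ℝ)..(2 * Real.pi), f (t + Real.pi) = ∫ t in (0 : ℝ)..(2 * Real.pi), f t := by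
  rw [intervalIntegral.integral_comp_add_right, zero_add, add_comm (2 * Real.pi)]
  simpa using hf.intervalIntegral_add_eq Real.pi 0

/-- For a `π`-periodic weight `W ≥ m` the kernel may be symmetrized; its symmetrization is
nonpositive, so the integral is at most the one for the constant weight `m`. -/
lemma re_integral_kernel_le {b : ℂ} (hb : ‖b‖ < 1) {W : ℝ → ℝ} {m : ℝ}
    (hW : Continuous W) (hper : Function.Periodic W Real.pi) (hm : ∀ t, m ≤ W t) :
    (∫ t in (0 : ℝ)..(2 * Real.pi), (b - (‖b‖ : ℂ) ^ 2 * circleMap 0 1 t) /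
      (circleMap 0 1 t + b) * (W t : ℂ)).re ≤ -(2 * Real.pi * ‖b‖ ^ 2 * m) := by
  set k : ℝ → ℝ := fun t =>
    ((b - (‖b‖ : ℂ) ^ 2 * circleMap 0 1 t) / (circleMap 0 1 t + b)).re with hk
  have hkc : Continuous k := continuous_re.comp (continuous_kernel hb)
  have hkp : Function.Periodic k (2 * Real.pi) := fun t => by
    simp only [hk, periodic_circleMap 0 1 t]
  have hWp : Function.Periodic W (2 * Real.pi) := by simpa using hper.nat_mul 2
  have hre : ∀ f : ℝ → ℂ, Continuous f → (∫ t in (0 : ℝ)..(2 * Real.pi), f t).re =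
      ∫ t in (0 : ℝ)..(2 * Real.pi), (f t).re := fun f hf =>
    (reCLM.intervalIntegral_comp_comm (hf.intervalIntegrable _ _)).symm
  have hs : Continuous fun t => k (t + Real.pi) := hkc.comp (by fun_prop)
  have hkW : Continuous fun t : ℝ => (b - (‖b‖ : ℂ) ^ 2 * circleMap 0 1 t) /
      (circleMap 0 1 t + b) * (W t : ℂ) :=
    (continuous_kernel hb).mul (continuous_ofReal.comp hW)
  rw [hre _ hkW]
  simp only [re_mul_ofReal]
  have hki : ∫ t in (0 : ℝ)..(2 * Real.pi), k t = -(2 * Real.pi * ‖b‖ ^ 2) := by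
    rw [hk, ← hre _ (continuous_kernel hb), integral_kernel hb]
    have : (-(2 * Real.pi * (‖b‖ : ℂ) ^ 2)) = ((-(2 * Real.pi * ‖b‖ ^ 2) : ℝ) : ℂ) := by
      push_cast; ring
    rw [this, ofReal_re]
  have h1 : ∫ t in (0 : ℝ)..(2 * Real.pi), k (t + Real.pi) * W t =
      ∫ t in (0 : ℝ)..(2 * Real.pi), k t * W t := by
    rw [← integral_comp_add_pi (f := fun t => k t * W t) (hkp.mul hWp)]
    simp only [hper _]
  have h2 : ∫ t in (0 : ℝ)..(2 * Real.pi), k (t + Real.pi) =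
      ∫ t in (0 : ℝ)..(2 * Real.pi), k t := integral_comp_add_pi hkp
  have h3 : ∫ t in (0 : ℝ)..(2 * Real.pi), (k t + k (t + Real.pi)) * W t ≤
      ∫ t in (0 : ℝ)..(2 * Real.pi), (k t + k (t + Real.pi)) * m := by
    refine intervalIntegral.integral_mono_on (by positivity)
      (((hkc.add hs).mul hW).intervalIntegrable _ _)
      (((hkc.add hs).mul continuous_const).intervalIntegrable _ _) fun t _ => ?_
    refine mul_le_mul_of_nonpos_left (hm t) ?_
    have := re_kernel_add_kernel_neg_nonpos (z := circleMap 0 1 t) hb (by simp)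
    simpa only [hk, circleMap_zero_one_add_pi] using this
  have e1 : ∫ t in (0 : ℝ)..(2 * Real.pi), (k t + k (t + Real.pi)) * W t =
      (∫ t in (0 : ℝ)..(2 * Real.pi), k t * W t) +
        ∫ t in (0 : ℝ)..(2 * Real.pi), k (t + Real.pi) * W t := by
    simp only [add_mul]
    exact intervalIntegral.integral_add ((hkc.mul hW).intervalIntegrable _ _)
      ((hs.mul hW).intervalIntegrable _ _)
  have e2 : ∫ t in (0 : ℝ)..(2 * Real.pi), (k t + k (t + Real.pi)) * m =
      ((∫ t in (0 : ℝ)..(2 * Real.pi), k t) +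
        ∫ t in (0 : ℝ)..(2 * Real.pi), k (t + Real.pi)) * m := by
    rw [intervalIntegral.integral_mul_const, intervalIntegral.integral_add
      (hkc.intervalIntegrable _ _) (hs.intervalIntegrable _ _)]
  rw [e1, e2, h1, h2, hki] at h3
  linarith

/-! ### The period of `dh / g` -/

section
variable {L : ℝ}

/-- The weight `z / w` on the unit circle of the first sheet, where it is real and positive. -/
noncomputable def circleWeight (L t : ℝ) : ℝ := (L * ‖1 + circleMap 0 1 t ^ 2 / (L : ℂ) ^ 2‖)⁻¹

lemma sheetRoot_circleMap (hL : 1 < L) (t : ℝ) :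
    sheetRoot L (circleMap 0 1 t) = ((circleWeight L t)⁻¹ : ℝ) := by
  rw [sheetRoot_of_norm_eq_one hL (by simp), circleWeight, inv_inv]

lemma norm_factor_circleMap_pos (hL : 1 < L) (t : ℝ) :
    0 < L * ‖1 + circleMap 0 1 t ^ 2 / (L : ℂ) ^ 2‖ := by
  have h := re_factor_pos (z := circleMap 0 1 t) hL (by simpa using hL)
  exact mul_pos (by linarith) (norm_pos_iff.2 fun h0 => by simp [h0] at h)

lemma continuous_circleWeight (hL : 1 < L) : Continuous (circleWeight L) :=
  Continuous.inv₀ (by fun_prop) fun t => (norm_factor_circleMap_pos hL t).ne'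

lemma circleWeight_periodic : Function.Periodic (circleWeight L) Real.pi := fun t => by
  simp [circleWeight, circleMap_zero_one_add_pi]

lemma inv_two_mul_le_circleWeight (hL : 1 < L) (t : ℝ) : (2 * L)⁻¹ ≤ circleWeight L t := by
  refine inv_anti₀ (norm_factor_circleMap_pos hL t) ?_
  rw [mul_comm]
  refine mul_le_mul_of_nonneg_right ?_ (by linarith)
  refine (norm_add_le _ _).trans ?_
  have : ‖circleMap 0 1 t ^ 2 / (L : ℂ) ^ 2‖ ≤ 1 := by
    rw [norm_div, norm_pow, norm_pow, norm_circleMap_zero, norm_real, abs_one, one_pow]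
    exact div_le_one_of_le₀ (by rw [Real.norm_eq_abs, sq_abs]; nlinarith) (by positivity)
  rw [norm_one]
  linarith

/-- The coefficient of `dz` in `dh / g`, up to a constant and the factor `1 / (z + b)`. -/
noncomputable def periodNum (L : ℝ) (b z : ℂ) : ℂ :=
  (1 - (starRingEnd ℂ) b * z) / (z * sheetRoot L z)

lemma mul_sheetRoot_ne_zero (hL : 1 < L) {z : ℂ} (hz : L⁻¹ < ‖z‖ ∧ ‖z‖ < L) :
    z * sheetRoot L z ≠ 0 :=
  mul_ne_zero (ne_zero_of_mem_annulus hL hz.1) (sheetRoot_ne_zero hL hz.1 hz.2)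

lemma periodNum_differentiableOn (hL : 1 < L) (b : ℂ) :
    DifferentiableOn ℂ (periodNum L b) {z | L⁻¹ < ‖z‖ ∧ ‖z‖ < L} :=
  DifferentiableOn.div (by fun_prop) (differentiableOn_id.mul (sheetRoot_differentiableOn hL))
    fun _ hz => mul_sheetRoot_ne_zero hL hz

lemma isAnnulusLoop_circleMap_zero (hL : 1 < L) {r : ℝ} (h1 : 1 ≤ r) (h2 : r < L) :
    IsAnnulusLoop L⁻¹ L (circleMap 0 r) :=
  isAnnulusLoop_circleMap (by simpa using (inv_lt_one_of_one_lt₀ hL).trans_le h1)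
    (by simpa using h2) (by positivity)

lemma circleMap_zero_add (b : ℂ) (r : ℝ) : (fun t => circleMap 0 r t + b) = circleMap b r := by
  funext t
  simp [circleMap, add_comm]

lemma re_period_unitCircle_le (hL : 1 < L) {b : ℂ} (hb : ‖b‖ < 1) :
    (b * -I * ∫ t in (0 : ℝ)..(2 * Real.pi), periodNum L b (circleMap 0 1 t) /
      (circleMap 0 1 t + b) * deriv (circleMap 0 1) t).re ≤ -(Real.pi * ‖b‖ ^ 2 / L) := by
  rw [← intervalIntegral.integral_const_mul]
  have e : ∀ t : ℝ, b * -I * (periodNum L b (circleMap 0 1 t) / (circleMap 0 1 t + b) *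
      deriv (circleMap 0 1) t) = (b - (‖b‖ : ℂ) ^ 2 * circleMap 0 1 t) /
      (circleMap 0 1 t + b) * (circleWeight L t : ℂ) := by
    intro t
    have h0 : circleMap 0 1 t ≠ 0 := circleMap_ne_center one_ne_zero
    have h1 := circleMap_add_ne_zero hb t
    have hn : (‖b‖ : ℂ) ^ 2 = b * (starRingEnd ℂ) b := (mul_conj' b).symm
    rw [periodNum, sheetRoot_circleMap hL, deriv_circleMap, hn, ofReal_inv]
    have hw : (circleWeight L t : ℂ) ≠ 0 := by
      have : 0 < circleWeight L t := inv_pos.2 (norm_factor_circleMap_pos hL t)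
      exact_mod_cast this.ne'
    field_simp
    linear_combination (-b * (1 - circleMap 0 1 t * (starRingEnd ℂ) b)) * I_sq
  simp only [e]
  refine (re_integral_kernel_le hb (continuous_circleWeight hL) circleWeight_periodic
    (inv_two_mul_le_circleWeight hL)).trans_eq ?_
  field_simp

/-- The period of `dh / g` does not vanish unless `g` vanishes over `z = 0`. For `|b| < 1` the
estimate on the unit circle applies; for `|b| = 1` the pole is on that circle, and the estimate
passes to the limit along the circle of a radius `r > 1`. -/
theorem period_ne_zero (hL : 1 < L) {b : ℂ} (hb : ‖b‖ ≤ 1) (hb0 : b ≠ 0) {z : ℝ → ℂ}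
    (hz : IsAnnulusLoop L⁻¹ L z) (hzb : ∀ t, z t + b ≠ 0)
    (hw : StdExample.winding (fun t => z t + b) = 1) :
    ∫ t in (0 : ℝ)..(2 * Real.pi), periodNum L b (z t) / (z t + b) * deriv z t ≠ 0 := by
  have hLi : 0 < L⁻¹ := by positivity
  obtain ⟨r, hr1, hrL⟩ := exists_between hL
  have hloop := isAnnulusLoop_circleMap_zero hL hr1.le hrL
  have hwind : ∀ {c : ℂ} {r : ℝ}, ‖c‖ < r →
      StdExample.winding (fun t => circleMap 0 r t + c) = 1 := fun h => by
    rw [circleMap_zero_add]; exact winding_circleMap h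
  rw [hz.integral_div_eq hLi (periodNum_differentiableOn hL b) hloop hzb
    (circleMap_add_ne_zero (hb.trans_lt hr1)) hw (hwind (hb.trans_lt hr1))]
  set J : ℂ → ℂ := fun c => ∫ t in (0 : ℝ)..(2 * Real.pi), periodNum L c (circleMap 0 r t) /
    (circleMap 0 r t + c) * deriv (circleMap 0 r) t with hJ
  have hlt : ∀ c : ℂ, ‖c‖ < 1 → (c * -I * J c).re ≤ -(Real.pi * ‖c‖ ^ 2 / L) := by
    intro c hc
    have e : J c = _ := hloop.integral_div_eq hLi (periodNum_differentiableOn hL c)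
      (isAnnulusLoop_circleMap_zero hL le_rfl hL) (circleMap_add_ne_zero (hc.trans hr1))
      (circleMap_add_ne_zero hc) (hwind (hc.trans hr1)) (hwind hc)
    rw [e]
    exact re_period_unitCircle_le hL hc
  -- Truncating the parameter to `[0, 1]` makes the integrand continuous everywhere.
  set p : ℝ → ℂ := fun s => ((max 0 (min s 1) : ℝ) : ℂ) * b with hp
  have hpc : Continuous p := by fun_prop
  have hpn : ∀ s, ‖p s‖ < r := by
    intro s
    refine lt_of_le_of_lt ?_ hr1
    rw [hp, norm_mul, norm_real, Real.norm_of_nonneg (le_max_left _ _)]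
    exact mul_le_one₀ (max_le zero_le_one (min_le_right _ _)) (norm_nonneg b) hb
  have hJc : Continuous fun s => J (p s) := by
    refine intervalIntegral.continuous_parametric_intervalIntegral_of_continuous' ?_ _ _
    have h1 : Continuous fun t => circleMap 0 r t * sheetRoot L (circleMap 0 r t) :=
      (continuous_id.continuousOn.mul (sheetRoot_differentiableOn hL).continuousOn).comp_continuous
        (continuous_circleMap 0 r) hloop.mem
    have h2 : ∀ t, circleMap 0 r t * sheetRoot L (circleMap 0 r t) ≠ 0 := fun t =>
      mul_sheetRoot_ne_zero hL (hloop.mem t)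
    have h3 : Continuous fun x : ℝ × ℝ => p x.1 := hpc.comp continuous_fst
    have h4 : Continuous fun x : ℝ × ℝ => circleMap 0 r x.2 :=
      (continuous_circleMap 0 r).comp continuous_snd
    have h5 : Continuous fun x : ℝ × ℝ => deriv (circleMap 0 r) x.2 :=
      ((contDiff_circleMap 0 r (n := 1)).continuous_deriv le_rfl).comp continuous_snd
    refine Continuous.mul (Continuous.div (Continuous.div ?_ (h1.comp continuous_snd)
      fun x => h2 x.2) (h4.add h3) fun x => circleMap_add_ne_zero (hpn x.1) x.2) h5
    exact continuous_const.sub ((continuous_conj.comp h3).mul h4)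
  have hclosed : IsClosed {s : ℝ | (p s * -I * J (p s)).re ≤ -(Real.pi * ‖p s‖ ^ 2 / L)} :=
    isClosed_le (continuous_re.comp ((hpc.mul continuous_const).mul hJc)) (by fun_prop)
  have hsub : Set.Ioo (0 : ℝ) 1 ⊆
      {s : ℝ | (p s * -I * J (p s)).re ≤ -(Real.pi * ‖p s‖ ^ 2 / L)} := by
    intro s hs
    have hps : p s = (s : ℂ) * b := by simp [hp, min_eq_left hs.2.le, max_eq_right hs.1.le]
    refine hlt _ ?_
    rw [hps, norm_mul, norm_real, Real.norm_of_nonneg hs.1.le]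
    exact (mul_le_of_le_one_right hs.1.le hb).trans_lt hs.2
  have h1 := closure_minimal hsub hclosed
    (by rw [closure_Ioo zero_ne_one]; exact Set.right_mem_Icc.2 zero_le_one)
  have hp1 : p 1 = b := by simp [hp]
  rw [Set.mem_ofPred_eq, hp1] at h1
  intro h0
  have h0' : J b = 0 := h0
  rw [h0', mul_zero, zero_re] at h1
  have : 0 < Real.pi * ‖b‖ ^ 2 / L := by
    have := norm_pos_iff.2 hb0
    positivity
  linarith

/-- If `g` vanishes over `z = 0`, the two halves of the unit circle cancel. -/
theorem period_eq_zero (hL : 1 < L) {z : ℝ → ℂ} (hz : IsAnnulusLoop L⁻¹ L z) :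
    ∫ t in (0 : ℝ)..(2 * Real.pi), periodNum L 0 (z t) / (z t + 0) * deriv z t = 0 := by
  have h0 : ∀ {y : ℝ → ℂ}, IsAnnulusLoop L⁻¹ L y → ∀ t, y t + 0 ≠ 0 := fun h t => by
    rw [add_zero]; exact ne_zero_of_mem_annulus hL (h.mem t).1
  have hu := isAnnulusLoop_circleMap_zero hL le_rfl hL
  rw [hz.integral_div_eq (by positivity) (periodNum_differentiableOn hL 0) hu (h0 hz) (h0 hu)
    (by simpa using hz.winding_eq) (by simpa using hu.winding_eq)]
  set f : ℝ → ℂ := fun t => periodNum L 0 (circleMap 0 1 t) / (circleMap 0 1 t + 0) *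
    deriv (circleMap 0 1) t with hf
  have hanti : ∀ t, f (t + Real.pi) = -f t := by
    intro t
    simp only [hf, periodNum, deriv_circleMap, sheetRoot_circleMap hL, circleWeight_periodic t,
      circleMap_zero_one_add_pi, map_zero, zero_mul, sub_zero, add_zero]
    have : circleMap 0 1 t ≠ 0 := circleMap_ne_center one_ne_zero
    field_simp
  have hper : Function.Periodic f (2 * Real.pi) := fun t => by
    rw [two_mul, ← add_assoc, hanti, hanti, neg_neg]
  have h := integral_comp_add_pi hper
  simp only [hanti, intervalIntegral.integral_neg] at h
  linear_combination (-1 / 2 : ℂ) * h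

end

/-! ### The period of `dh` and the elliptic integral -/

section
variable {θ : ℝ}

lemma one_lt_lam (hθ : θ ∈ Set.Ioo (0 : ℝ) (Real.pi / 2)) : 1 < StdExample.lam θ := by
  have hp := Real.pi_pos
  have h1 : Real.sin (θ / 2) < Real.sin (Real.pi / 4) :=
    Real.sin_lt_sin_of_lt_of_le_pi_div_two (by linarith [hθ.1]) (by linarith)
      (by linarith [hθ.2])
  have h2 : Real.cos (Real.pi / 4) < Real.cos (θ / 2) :=
    Real.cos_lt_cos_of_nonneg_of_le_pi (by linarith [hθ.1]) (by linarith) (by linarith [hθ.2])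
  have h3 : 0 < Real.sin (θ / 2) :=
    Real.sin_pos_of_pos_of_lt_pi (by linarith [hθ.1]) (by linarith [hθ.2])
  rw [StdExample.lam, Real.cot_eq_cos_div_sin, one_lt_div h3]
  rw [Real.sin_pi_div_four] at h1
  rw [Real.cos_pi_div_four] at h2
  linarith

lemma sin_pos_of_mem (hθ : θ ∈ Set.Ioo (0 : ℝ) (Real.pi / 2)) : 0 < Real.sin θ :=
  Real.sin_pos_of_pos_of_lt_pi hθ.1 (by linarith [hθ.2, Real.pi_pos])

lemma lam_add_inv (hθ : θ ∈ Set.Ioo (0 : ℝ) (Real.pi / 2)) :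
    StdExample.lam θ + (StdExample.lam θ)⁻¹ = 2 / Real.sin θ := by
  have hp := Real.pi_pos
  have h3 : 0 < Real.sin (θ / 2) :=
    Real.sin_pos_of_pos_of_lt_pi (by linarith [hθ.1]) (by linarith [hθ.2])
  have h4 : 0 < Real.cos (θ / 2) :=
    Real.cos_pos_of_mem_Ioo ⟨by linarith [hθ.1], by linarith [hθ.2]⟩
  have h5 : Real.sin θ = 2 * Real.sin (θ / 2) * Real.cos (θ / 2) := by
    rw [← Real.sin_two_mul]; ring_nf
  rw [StdExample.lam, Real.cot_eq_cos_div_sin, h5]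
  field_simp
  linear_combination Real.sin_sq_add_cos_sq (θ / 2)

lemma sin_sq_mul_sin_sq_lt_one (hθ : θ ∈ Set.Ioo (0 : ℝ) (Real.pi / 2)) (t : ℝ) :
    Real.sin θ ^ 2 * Real.sin t ^ 2 < 1 := by
  have h1 : Real.sin θ ^ 2 < 1 := by
    have : 0 < Real.cos θ := Real.cos_pos_of_mem_Ioo ⟨by linarith [hθ.1, Real.pi_pos], hθ.2⟩
    nlinarith [Real.sin_sq_add_cos_sq θ]
  exact (mul_le_of_le_one_right (sq_nonneg _) (Real.sin_sq_le_one t)).trans_lt h1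

lemma circleWeight_eq (hθ : θ ∈ Set.Ioo (0 : ℝ) (Real.pi / 2)) (t : ℝ) :
    circleWeight (StdExample.lam θ) t =
      Real.sin θ / 2 * (1 / Real.sqrt (1 - Real.sin θ ^ 2 * Real.sin t ^ 2)) := by
  have hL := one_lt_lam hθ
  have hs := sin_pos_of_mem hθ
  have hsum := lam_add_inv hθ
  set L := StdExample.lam θ
  have hL0 : L ≠ 0 := by linarith
  have hq := sub_pos.2 (sin_sq_mul_sin_sq_lt_one hθ t)
  have key : L * ‖1 + circleMap 0 1 t ^ 2 / (L : ℂ) ^ 2‖ =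
      2 / Real.sin θ * Real.sqrt (1 - Real.sin θ ^ 2 * Real.sin t ^ 2) := by
    rw [← sq_eq_sq₀ (norm_factor_circleMap_pos hL t).le (by positivity), mul_pow, mul_pow,
      Real.sq_sqrt hq.le, ← normSq_eq_norm_sq]
    have e : (1 + circleMap 0 1 t ^ 2 / (L : ℂ) ^ 2) =
        ((1 + (Real.cos t ^ 2 - Real.sin t ^ 2) / L ^ 2 : ℝ) : ℂ) +
          ((2 * Real.sin t * Real.cos t / L ^ 2 : ℝ) : ℂ) * I := by
      simp only [circleMap, zero_add, ofReal_one, one_mul, exp_mul_I]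
      push_cast
      linear_combination (sin (t : ℂ)) ^ 2 / (L : ℂ) ^ 2 * I_sq
    have h2 : (2 / Real.sin θ) ^ 2 * (1 - Real.sin θ ^ 2 * Real.sin t ^ 2) =
        (2 / Real.sin θ) ^ 2 - 4 * Real.sin t ^ 2 := by
      field_simp
      ring
    rw [e, normSq_add_mul_I, h2, ← hsum]
    have hc : Real.cos t ^ 2 = 1 - Real.sin t ^ 2 := Real.cos_sq' t
    have : (2 * Real.sin t * Real.cos t / L ^ 2) ^ 2 =
        4 * Real.sin t ^ 2 * (1 - Real.sin t ^ 2) / L ^ 4 := by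
      rw [div_pow, mul_pow, mul_pow, hc]; ring
    rw [this, hc]
    field_simp
    ring
  rw [circleWeight, key]
  field_simp

lemma integral_circleWeight (hθ : θ ∈ Set.Ioo (0 : ℝ) (Real.pi / 2)) :
    ∫ t in (0 : ℝ)..(2 * Real.pi), circleWeight (StdExample.lam θ) t =
      2 * Real.sin θ * StdExample.ellipticK (Real.sin θ ^ 2) := by
  have hc := continuous_circleWeight (one_lt_lam hθ)
  have hper : Function.Periodic (circleWeight (StdExample.lam θ)) Real.pi :=
    circleWeight_periodic
  set W := circleWeight (StdExample.lam θ)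
  have hint : ∀ a b : ℝ, IntervalIntegrable W volume a b := fun a b => hc.intervalIntegrable a b
  have h1 : ∫ t in (0 : ℝ)..(2 * Real.pi), W t = 2 * ∫ t in (0 : ℝ)..Real.pi, W t := by
    rw [← intervalIntegral.integral_add_adjacent_intervals (hint 0 Real.pi) (hint _ _), two_mul,
      two_mul]
    congr 1
    simpa using hper.intervalIntegral_add_eq Real.pi 0
  have h2 : ∫ t in (0 : ℝ)..Real.pi, W t = 2 * ∫ t in (0 : ℝ)..(Real.pi / 2), W t := by
    rw [← intervalIntegral.integral_add_adjacent_intervals (hint 0 (Real.pi / 2)) (hint _ _),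
      two_mul]
    congr 1
    have hsymm : ∀ t, W (Real.pi - t) = W t := fun t => by
      simp only [W, circleWeight_eq hθ, Real.sin_pi_sub]
    have := intervalIntegral.integral_comp_sub_left (a := 0) (b := Real.pi / 2) W Real.pi
    simp only [hsymm, sub_zero] at this
    rw [this]
    congr 1
    ring
  have h3 : ∫ t in (0 : ℝ)..(Real.pi / 2), W t =
      Real.sin θ / 2 * StdExample.ellipticK (Real.sin θ ^ 2) := by
    rw [StdExample.ellipticK, ← intervalIntegral.integral_const_mul]
    simp only [W, circleWeight_eq hθ]
  rw [h1, h2, h3]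
  ring

lemma mu_pos (hθ : θ ∈ Set.Ioo (0 : ℝ) (Real.pi / 2)) :
    0 < StdExample.mu θ ∧
      StdExample.mu θ * (2 * Real.sin θ * StdExample.ellipticK (Real.sin θ ^ 2)) =
        2 * Real.pi := by
  have hL := one_lt_lam hθ
  have hs := sin_pos_of_mem hθ
  have hI : 0 < ∫ t in (0 : ℝ)..(2 * Real.pi), circleWeight (StdExample.lam θ) t :=
    intervalIntegral.intervalIntegral_pos_of_pos
      ((continuous_circleWeight hL).intervalIntegrable _ _)
      (fun t => inv_pos.2 (norm_factor_circleMap_pos hL t)) (by positivity)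
  rw [integral_circleWeight hθ] at hI
  have hK : 0 < StdExample.ellipticK (Real.sin θ ^ 2) :=
    pos_of_mul_pos_right hI (by positivity)
  have hp := Real.pi_pos
  refine ⟨div_pos hp (by positivity), ?_⟩
  rw [StdExample.mu]
  field_simp

/-- The period of `dh` is `2πi`; this is what the normalization `μ` is chosen for. -/
theorem integral_height (hθ : θ ∈ Set.Ioo (0 : ℝ) (Real.pi / 2)) {z : ℝ → ℂ}
    (hz : IsAnnulusLoop (StdExample.lam θ)⁻¹ (StdExample.lam θ) z) :
    ∫ t in (0 : ℝ)..(2 * Real.pi), (StdExample.mu θ : ℂ) /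
      (z t * sheetRoot (StdExample.lam θ) (z t)) * deriv z t = 2 * Real.pi * I := by
  have hL := one_lt_lam hθ
  have hG : DifferentiableOn ℂ (fun z => (StdExample.mu θ : ℂ) /
      (z * sheetRoot (StdExample.lam θ) z))
      {z | (StdExample.lam θ)⁻¹ < ‖z‖ ∧ ‖z‖ < StdExample.lam θ} :=
    (differentiableOn_const _).div (differentiableOn_id.mul (sheetRoot_differentiableOn hL))
      fun _ h => mul_sheetRoot_ne_zero hL h
  rw [hz.integral_eq (by positivity) hG (isAnnulusLoop_circleMap_zero hL le_rfl hL)]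
  have e : ∀ t : ℝ, (StdExample.mu θ : ℂ) / (circleMap 0 1 t *
      sheetRoot (StdExample.lam θ) (circleMap 0 1 t)) * deriv (circleMap 0 1) t =
      ((StdExample.mu θ * circleWeight (StdExample.lam θ) t : ℝ) : ℂ) * I := by
    intro t
    have h0 : circleMap 0 1 t ≠ 0 := circleMap_ne_center one_ne_zero
    rw [sheetRoot_circleMap hL, deriv_circleMap]
    push_cast
    rw [div_mul_eq_div_div, div_inv_eq_mul]
    field_simp
  simp only [e]
  rw [intervalIntegral.integral_mul_const, intervalIntegral.integral_ofReal,
    intervalIntegral.integral_const_mul, integral_circleWeight hθ, (mu_pos hθ).2]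
  push_cast
  ring

end

/-! ### The Gauss map and the antipodal symmetry -/

lemma winding_const_mul {c : ℂ} (hc : c ≠ 0) (f : ℝ → ℂ) :
    StdExample.winding (fun t => c * f t) = StdExample.winding f := by
  simp only [StdExample.winding, deriv_const_mul_field, mul_div_mul_left _ _ hc]

section
variable {α β : ℝ}

lemma normSq_sig : normSq (StdExample.sig α β) = 1 + Real.cos α * Real.cos β := by
  have h1 := Real.cos_sq ((α + β) / 2)
  have h2 := Real.cos_sq ((α - β) / 2)
  rw [mul_div_cancel₀ _ two_ne_zero] at h1 h2
  rw [StdExample.sig, mul_comm I, normSq_add_mul_I, h1, h2, Real.cos_add, Real.cos_sub]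
  ring

lemma normSq_del : normSq (StdExample.del α β) = 1 - Real.cos α * Real.cos β := by
  have h1 := Real.sin_sq_eq_half_sub ((α + β) / 2)
  have h2 := Real.sin_sq_eq_half_sub ((α - β) / 2)
  rw [mul_div_cancel₀ _ two_ne_zero] at h1 h2
  rw [StdExample.del, mul_comm I, normSq_add_mul_I, h1, h2, Real.cos_add, Real.cos_sub]
  ring

/-- The zero of the Gauss map lies over `z = -b` with `b = δ / σ`, and its pole over
`z = 1 / conj b`. -/
noncomputable def zeroParam (α β : ℝ) : ℂ := StdExample.del α β / StdExample.sig α β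

lemma cos_mul_cos_nonneg (hα : α ∈ Set.Icc (0 : ℝ) (Real.pi / 2))
    (hβ : β ∈ Set.Icc (0 : ℝ) (Real.pi / 2)) : 0 ≤ Real.cos α * Real.cos β :=
  mul_nonneg (Real.cos_nonneg_of_mem_Icc ⟨by linarith [hα.1, Real.pi_pos], hα.2⟩)
    (Real.cos_nonneg_of_mem_Icc ⟨by linarith [hβ.1, Real.pi_pos], hβ.2⟩)

lemma sig_ne_zero (h : 0 ≤ Real.cos α * Real.cos β) : StdExample.sig α β ≠ 0 :=
  normSq_pos.1 (by rw [normSq_sig]; linarith)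

lemma norm_zeroParam_le (h : 0 ≤ Real.cos α * Real.cos β) : ‖zeroParam α β‖ ≤ 1 := by
  rw [zeroParam, norm_div]
  refine div_le_one_of_le₀ ?_ (norm_nonneg _)
  rw [← sq_le_sq₀ (norm_nonneg _) (norm_nonneg _), ← normSq_eq_norm_sq, ← normSq_eq_norm_sq,
    normSq_sig, normSq_del]
  linarith

lemma zeroParam_eq_zero_iff (hα : α ∈ Set.Icc (0 : ℝ) (Real.pi / 2))
    (hβ : β ∈ Set.Icc (0 : ℝ) (Real.pi / 2)) : zeroParam α β = 0 ↔ α = 0 ∧ β = 0 := by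
  have hp := Real.pi_pos
  rw [zeroParam, div_eq_zero_iff, or_iff_left (sig_ne_zero (cos_mul_cos_nonneg hα hβ)),
    ← normSq_eq_zero, normSq_del, sub_eq_zero]
  constructor
  · intro h
    have h1 := Real.cos_le_one α
    have h2 := Real.cos_le_one β
    have h3 : 0 ≤ Real.cos α :=
      Real.cos_nonneg_of_mem_Icc ⟨by linarith [hα.1], hα.2⟩
    have h4 : 0 ≤ Real.cos β :=
      Real.cos_nonneg_of_mem_Icc ⟨by linarith [hβ.1], hβ.2⟩
    have e1 : Real.cos α = 1 := by nlinarith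
    have e2 : Real.cos β = 1 := by nlinarith
    exact ⟨(Real.cos_eq_one_iff_of_lt_of_lt (by linarith [hα.1]) (by linarith [hα.2])).1 e1,
      (Real.cos_eq_one_iff_of_lt_of_lt (by linarith [hβ.1]) (by linarith [hβ.2])).1 e2⟩
  · rintro ⟨rfl, rfl⟩
    simp

lemma gaussNum_eq (hs : StdExample.sig α β ≠ 0) (z : ℂ) :
    StdExample.gaussNum α β z = StdExample.sig α β * (z + zeroParam α β) := by
  rw [StdExample.gaussNum, zeroParam]
  field_simp

lemma gaussDen_eq (hs : StdExample.sig α β ≠ 0) (z : ℂ) :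
    StdExample.gaussDen α β z = (starRingEnd ℂ) (StdExample.sig α β) *
      (1 - (starRingEnd ℂ) (zeroParam α β) * z) := by
  have : (starRingEnd ℂ) (StdExample.sig α β) ≠ 0 := by simpa using hs
  rw [StdExample.gaussDen, zeroParam, map_div₀]
  field_simp

end

/-- The image of a curve under the antipodal map `z ↦ -1 / conj z`. -/
noncomputable def antipode (z : ℝ → ℂ) (t : ℝ) : ℂ := -((starRingEnd ℂ) (z t))⁻¹

section
variable {L : ℝ} {b : ℂ} {z : ℝ → ℂ}

lemma hasDerivAt_antipode (hd : ContDiff ℝ 1 z) (h0 : ∀ t, z t ≠ 0) (t : ℝ) :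
    HasDerivAt (antipode z) ((starRingEnd ℂ) (deriv z t) / (starRingEnd ℂ) (z t) ^ 2) t := by
  have h1 := (hd.differentiable (by norm_num) t).hasDerivAt
  have h2 : HasDerivAt (fun t => (starRingEnd ℂ) (z t)) ((starRingEnd ℂ) (deriv z t)) t :=
    h1.star
  refine (h2.inv (by simpa using h0 t)).neg.congr_deriv ?_
  rw [neg_div, neg_neg]

lemma IsAnnulusLoop.ne_zero (hL : 1 < L) (hz : IsAnnulusLoop L⁻¹ L z) (t : ℝ) : z t ≠ 0 :=
  ne_zero_of_mem_annulus hL (hz.mem t).1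

lemma IsAnnulusLoop.antipode (hL : 1 < L) (hz : IsAnnulusLoop L⁻¹ L z) :
    IsAnnulusLoop L⁻¹ L (antipode z) where
  smooth := by
    have hc : ContDiff ℝ 1 fun t => (starRingEnd ℂ) (z t) := conjCLE.contDiff.comp hz.smooth
    exact (hc.inv fun t => by simpa using hz.ne_zero hL t).neg
  closed := by simp only [_root_.antipode, hz.closed]
  mem t := by
    have h0 := norm_pos_iff.2 (hz.ne_zero hL t)
    have hL0 : 0 < L := by linarith
    have := hz.mem t
    simp only [_root_.antipode, norm_neg, norm_inv, norm_conj]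
    exact ⟨inv_strictAnti₀ h0 this.2, inv_lt_of_inv_lt₀ hL0 this.1⟩
  winding_eq := by
    apply winding_eq_of_integral
    have e : ∀ t, deriv (_root_.antipode z) t / _root_.antipode z t =
        -(starRingEnd ℂ) (deriv z t / z t) := by
      intro t
      have h0 : (starRingEnd ℂ) (z t) ≠ 0 := by simpa using hz.ne_zero hL t
      rw [(hasDerivAt_antipode hz.smooth (hz.ne_zero hL) t).deriv, _root_.antipode, map_div₀]
      field_simp
    simp only [e]
    rw [intervalIntegral.integral_neg, intervalIntegral.intervalIntegral_conj,
      integral_logDeriv_of_winding hz.winding_eq]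
    simp [map_ofNat]

lemma antipode_add_eq (hL : 1 < L) (hz : IsAnnulusLoop L⁻¹ L z) (t : ℝ) :
    antipode z t + b =
      -((starRingEnd ℂ) (1 - (starRingEnd ℂ) b * z t)) / (starRingEnd ℂ) (z t) := by
  have h0 : (starRingEnd ℂ) (z t) ≠ 0 := by simpa using hz.ne_zero hL t
  rw [antipode]
  simp only [map_sub, map_mul, map_one, conj_conj]
  field_simp
  ring

lemma antipode_add_ne_zero (hL : 1 < L) (hz : IsAnnulusLoop L⁻¹ L z)
    (hp : ∀ t, 1 - (starRingEnd ℂ) b * z t ≠ 0) (t : ℝ) : antipode z t + b ≠ 0 := by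
  rw [antipode_add_eq hL hz]
  exact div_ne_zero (neg_ne_zero.2 (by rw [Ne, map_eq_zero]; exact hp t))
    (by simpa using hz.ne_zero hL t)

/-- The antipodal map exchanges the zero and the pole of the Gauss map. -/
lemma winding_antipode_add (hL : 1 < L) (hz : IsAnnulusLoop L⁻¹ L z)
    (hp : ∀ t, 1 - (starRingEnd ℂ) b * z t ≠ 0)
    (hwp : StdExample.winding (fun t => 1 - (starRingEnd ℂ) b * z t) = 0) :
    StdExample.winding (fun t => antipode z t + b) = 1 := by
  apply winding_eq_of_integral
  have hdz := hz.smooth.continuous_deriv le_rfl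
  have hd : ∀ t, deriv (fun t => 1 - (starRingEnd ℂ) b * z t) t =
      -((starRingEnd ℂ) b * deriv z t) := fun t => by
    rw [deriv_const_sub, deriv_const_mul_field]
  have e : ∀ t, deriv (fun t => antipode z t + b) t / (antipode z t + b) =
      (starRingEnd ℂ) (deriv (fun t => 1 - (starRingEnd ℂ) b * z t) t /
        (1 - (starRingEnd ℂ) b * z t) - deriv z t / z t) := by
    intro t
    have h0 : (starRingEnd ℂ) (z t) ≠ 0 := by simpa using hz.ne_zero hL t
    have h1 : 1 - (starRingEnd ℂ) (z t) * b ≠ 0 := by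
      have := (map_ne_zero (starRingEnd ℂ)).2 (hp t)
      simpa [mul_comm] using this
    rw [deriv_add_const, (hasDerivAt_antipode hz.smooth (hz.ne_zero hL) t).deriv,
      antipode_add_eq hL hz, hd]
    simp only [map_sub, map_mul, map_one, conj_conj, map_div₀, map_neg]
    field_simp
    ring
  have c1 : Continuous fun t => deriv (fun t => 1 - (starRingEnd ℂ) b * z t) t /
      (1 - (starRingEnd ℂ) b * z t) := by
    simp only [hd]
    exact (continuous_const.mul hdz).neg.div
      (continuous_const.sub (continuous_const.mul hz.smooth.continuous)) hp
  have c2 : Continuous fun t => deriv z t / z t :=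
    hdz.div hz.smooth.continuous (hz.ne_zero hL)
  simp only [e]
  rw [intervalIntegral.intervalIntegral_conj, intervalIntegral.integral_sub
    (c1.intervalIntegrable _ _) (c2.intervalIntegrable _ _), integral_logDeriv_of_winding hwp,
    integral_logDeriv_of_winding hz.winding_eq]
  simp [map_ofNat]

/-- The symmetry `g ∘ τ = -1 / conj g`, `τ^* dh = - conj dh` for the antipodal map `τ`: the
pull-back of `dh / g` is the conjugate of `g dh`. -/
lemma periodNum_antipode (hL : 1 < L) (hz : IsAnnulusLoop L⁻¹ L z)
    (hp : ∀ t, 1 - (starRingEnd ℂ) b * z t ≠ 0) (t : ℝ) :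
    periodNum L b (antipode z t) / (antipode z t + b) * deriv (antipode z) t =
      (starRingEnd ℂ) ((z t + b) / (1 - (starRingEnd ℂ) b * z t) / (z t * sheetRoot L (z t)) *
        deriv z t) := by
  have h0 : (starRingEnd ℂ) (z t) ≠ 0 := by simpa using hz.ne_zero hL t
  have h1 : 1 - (starRingEnd ℂ) (z t) * b ≠ 0 := by
    have := (map_ne_zero (starRingEnd ℂ)).2 (hp t)
    simpa [mul_comm] using this
  have h2 : (starRingEnd ℂ) (sheetRoot L (z t)) ≠ 0 := by
    simpa using sheetRoot_ne_zero hL (hz.mem t).1 (hz.mem t).2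
  rw [antipode_add_eq hL hz, (hasDerivAt_antipode hz.smooth (hz.ne_zero hL) t).deriv, periodNum,
    antipode, sheetRoot_neg_inv_conj hL (hz.mem t).1 (hz.mem t).2]
  simp only [map_sub, map_add, map_mul, map_one, conj_conj, map_div₀]
  field_simp
  ring

/-- The periods of `g dh` and of `dh / g` are conjugate, up to a constant. -/
theorem integral_pole_eq_conj (hL : 1 < L) (hz : IsAnnulusLoop L⁻¹ L z)
    (hb : ∀ t, z t + b ≠ 0) (hp : ∀ t, 1 - (starRingEnd ℂ) b * z t ≠ 0)
    (hw : StdExample.winding (fun t => z t + b) = 1)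
    (hwp : StdExample.winding (fun t => 1 - (starRingEnd ℂ) b * z t) = 0) :
    ∫ t in (0 : ℝ)..(2 * Real.pi), (z t + b) / (1 - (starRingEnd ℂ) b * z t) /
        (z t * sheetRoot L (z t)) * deriv z t =
      (starRingEnd ℂ) (∫ t in (0 : ℝ)..(2 * Real.pi),
        periodNum L b (z t) / (z t + b) * deriv z t) := by
  rw [hz.integral_div_eq (by positivity) (periodNum_differentiableOn hL b) (hz.antipode hL) hb
    (antipode_add_ne_zero hL hz hp) hw (winding_antipode_add hL hz hp hwp)]
  simp only [periodNum_antipode hL hz hp]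
  rw [intervalIntegral.intervalIntegral_conj, conj_conj]

end

/-! ### Existence of the curve and its flux -/

section
variable {θ α β : ℝ}

/-- A circle through the annulus whose center is pushed slightly from `0` towards the zero `-b`
of the Gauss map encloses that zero and leaves the pole `1 / conj b` outside, even when both are
on the unit circle. -/
theorem exists_isGammaTwo (hL : 1 < StdExample.lam θ) (hC : 0 ≤ Real.cos α * Real.cos β) :
    ∃ γ : ℝ → ℂ × ℂ, StdExample.IsGammaTwo θ α β γ := by
  have hs := sig_ne_zero hC
  have hsc : (starRingEnd ℂ) (StdExample.sig α β) ≠ 0 := by simpa using hs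
  have hb := norm_zeroParam_le hC
  have hnum : ∀ z, StdExample.gaussNum α β z = _ := gaussNum_eq hs
  have hden : ∀ z, StdExample.gaussDen α β z = _ := gaussDen_eq hs
  set L := StdExample.lam θ
  set b := zeroParam α β
  have hLi : L⁻¹ < 1 := inv_lt_one_of_one_lt₀ hL
  have hLi0 : 0 < L⁻¹ := by positivity
  set η : ℝ := (1 - L⁻¹) / 2 with hη
  have hη0 : 0 < η := by linarith
  have hη1 : η < 1 := by linarith
  have hηL : 1 + η < L := by
    -- `L + L⁻¹ ≥ 2`
    have : L * L⁻¹ = 1 := mul_inv_cancel₀ (by linarith)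
    nlinarith
  set c : ℂ := -((η : ℂ) * b) with hcdef
  have hc : ‖c‖ ≤ η := by
    rw [hcdef, norm_neg, norm_mul, norm_real, Real.norm_of_nonneg hη0.le]
    exact mul_le_of_le_one_right hη0.le hb
  have hloop : IsAnnulusLoop L⁻¹ L (circleMap c 1) :=
    isAnnulusLoop_circleMap (by linarith) (by linarith) hLi0
  have hshift : ∀ t, circleMap c 1 t + b = circleMap (c + b) 1 t := fun t => by
    simp only [circleMap]; ring
  have hcb : ‖c + b‖ < 1 := by
    have : c + b = ((1 - η : ℝ) : ℂ) * b := by rw [hcdef]; push_cast; ring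
    rw [this, norm_mul, norm_real, Real.norm_of_nonneg (by linarith)]
    exact (mul_le_of_le_one_right (by linarith) hb).trans_lt (by linarith)
  have hzero : ∀ t, circleMap c 1 t + b ≠ 0 := fun t h => by
    rw [hshift] at h
    exact circleMap_add_ne_zero hcb t ((congrFun (circleMap_zero_add (c + b) 1) t).trans h)
  -- At `z = u + c` with `|u| ≤ 1`, a zero of `1 - conj b z` would give `1 + η |b|² = conj b u`,
  -- which is impossible for `|b| ≤ 1`.
  have hpole : ∀ z ∈ Metric.closedBall c 1, 1 - (starRingEnd ℂ) b * z ≠ 0 := by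
    intro z hz h
    have hz' : ‖z - c‖ ≤ 1 := by simpa [dist_eq_norm] using hz
    have e : (starRingEnd ℂ) b * (z - c) = ((1 + η * ‖b‖ ^ 2 : ℝ) : ℂ) := by
      have hn : (‖b‖ : ℂ) ^ 2 = b * (starRingEnd ℂ) b := (mul_conj' b).symm
      rw [hcdef]
      push_cast
      rw [hn]
      linear_combination -h
    have e' := congrArg norm e
    rw [norm_mul, norm_conj, norm_real, Real.norm_of_nonneg (by positivity)] at e'
    have h1 : ‖b‖ * ‖z - c‖ ≤ ‖b‖ := mul_le_of_le_one_right (norm_nonneg b) hz'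
    have h2 : η * ‖b‖ ^ 2 ≤ 0 := by linarith
    have h3 : ‖b‖ ^ 2 = 0 := le_antisymm (nonpos_of_mul_nonpos_right h2 hη0) (sq_nonneg _)
    have h4 : ‖b‖ = 0 := pow_eq_zero_iff two_ne_zero |>.1 h3
    rw [h4] at e'
    norm_num at e'
  have hmem : ∀ t, circleMap c 1 t ∈ Metric.closedBall c 1 := fun t =>
    circleMap_mem_closedBall c zero_le_one t
  refine ⟨fun t => (circleMap c 1 t, circleMap c 1 t * sheetRoot L (circleMap c 1 t)),
    ?_, ?_, ?_, ?_, ?_, ?_, ?_, ?_⟩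
  · refine hloop.smooth.prodMk (hloop.smooth.mul (contDiff_iff_contDiffAt.2 fun t => ?_))
    have h := (sheetRoot_contDiffAt hL (hloop.mem t).1 (hloop.mem t).2).restrict_scalars ℝ
    exact h.comp t hloop.smooth.contDiffAt
  · intro t
    simp only [periodic_circleMap c 1 t]
  · exact fun t => mk_mul_sheetRoot_mem_firstSheet hL (hloop.mem t).1 (hloop.mem t).2
  · intro t
    rw [hnum]
    exact mul_ne_zero hs (hzero t)
  · intro t
    rw [hden]
    exact mul_ne_zero hsc (hpole _ (hmem t))
  · exact hloop.winding_eq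
  · simp only [hnum]
    rw [winding_const_mul hs]
    simp only [hshift]
    exact winding_circleMap hcb
  · simp only [hden]
    rw [winding_const_mul hsc]
    apply winding_eq_of_integral
    have h := circleIntegral_eq_zero_of_differentiable_on_off_countable (R := 1) (c := c)
      (f := fun z => -(starRingEnd ℂ) b / (1 - (starRingEnd ℂ) b * z)) zero_le_one
      Set.countable_empty (ContinuousOn.div (by fun_prop) (by fun_prop) hpole) fun z hz =>
        DifferentiableAt.div (by fun_prop) (by fun_prop)
          (hpole z (Metric.ball_subset_closedBall hz.1))
    rw [mul_zero, ← h, circleIntegral]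
    congr 1
    funext t
    rw [deriv_const_sub, deriv_const_mul_field, smul_eq_mul]
    ring

/-- The period `∫ dh / g` of a curve with first coordinate `z`, up to a constant factor. -/
noncomputable def gaussPeriod (L : ℝ) (b : ℂ) (z : ℝ → ℂ) : ℂ :=
  ∫ t in (0 : ℝ)..(2 * Real.pi), periodNum L b (z t) / (z t + b) * deriv z t

/-- The flux along `γ₂` through the period `A` of `dh / g`: since the period of `g dh` is
`conj A`, the horizontal flux is `(Im A, Re A)`; the vertical one is always `2π`. -/
theorem exists_flux_eq (hθ : θ ∈ Set.Ioo (0 : ℝ) (Real.pi / 2))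
    (hC : 0 ≤ Real.cos α * Real.cos β) {γ : ℝ → ℂ × ℂ} (hγ : StdExample.IsGammaTwo θ α β γ) :
    ∃ κ : ℂ, κ ≠ 0 ∧ ∃ z : ℝ → ℂ,
      IsAnnulusLoop (StdExample.lam θ)⁻¹ (StdExample.lam θ) z ∧
      (∀ t, z t + zeroParam α β ≠ 0) ∧
      StdExample.winding (fun t => z t + zeroParam α β) = 1 ∧
      StdExample.flux θ α β γ = ![(κ * gaussPeriod (StdExample.lam θ) (zeroParam α β) z).im,
        (κ * gaussPeriod (StdExample.lam θ) (zeroParam α β) z).re, 2 * Real.pi] := by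
  have hL := one_lt_lam hθ
  have hs := sig_ne_zero hC
  have hsc : (starRingEnd ℂ) (StdExample.sig α β) ≠ 0 := by simpa using hs
  have hμ : (StdExample.mu θ : ℂ) ≠ 0 := by exact_mod_cast (mu_pos hθ).1.ne'
  have hnum : ∀ z, StdExample.gaussNum α β z = _ := gaussNum_eq hs
  have hden : ∀ z, StdExample.gaussDen α β z = _ := gaussDen_eq hs
  set b := zeroParam α β
  set σ := StdExample.sig α β
  have hzb : ∀ t, (γ t).1 + b ≠ 0 := fun t h => hγ.avoids_zeros t (by rw [hnum, h, mul_zero])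
  have hzp : ∀ t, 1 - (starRingEnd ℂ) b * (γ t).1 ≠ 0 := fun t h =>
    hγ.avoids_poles t (by rw [hden, h, mul_zero])
  have hw : StdExample.winding (fun t => (γ t).1 + b) = 1 := by
    have := hγ.winding_zero
    simp only [hnum] at this
    rwa [winding_const_mul hs] at this
  have hwp : StdExample.winding (fun t => 1 - (starRingEnd ℂ) b * (γ t).1) = 0 := by
    have := hγ.winding_pole
    simp only [hden] at this
    rwa [winding_const_mul hsc] at this
  set z : ℝ → ℂ := fun t => (γ t).1 with hz
  have hloop : IsAnnulusLoop (StdExample.lam θ)⁻¹ (StdExample.lam θ) z :=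
    { smooth := hγ.smooth.fst
      closed := by
        have := hγ.closed 0
        rw [zero_add] at this
        simp only [hz, this]
      mem := fun t => ⟨(hγ.mem_sheet t).2.1, (hγ.mem_sheet t).2.2.1⟩
      winding_eq := hγ.winding_origin }
  have hsnd : ∀ t, (γ t).2 = z t * sheetRoot (StdExample.lam θ) (z t) := fun t =>
    eq_mul_sheetRoot_of_mem_firstSheet hL (hγ.mem_sheet t)
  set κ : ℂ := I * (starRingEnd ℂ) σ / σ * StdExample.mu θ with hκ
  have hκ0 : κ ≠ 0 := mul_ne_zero (div_ne_zero (mul_ne_zero I_ne_zero hsc) hs) hμ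
  have hκc : (starRingEnd ℂ) κ = -I * σ / (starRingEnd ℂ) σ * StdExample.mu θ := by
    simp [hκ]
  refine ⟨κ, hκ0, z, hloop, hzb, hw, ?_⟩
  set A : ℂ := κ * gaussPeriod (StdExample.lam θ) b z with hA
  set p : ℝ → ℂ := fun t =>
    periodNum (StdExample.lam θ) b (z t) / (z t + b) * deriv z t with hp
  set q : ℝ → ℂ := fun t => (z t + b) / (1 - (starRingEnd ℂ) b * z t) /
    (z t * sheetRoot (StdExample.lam θ) (z t)) * deriv z t with hq
  have hqp : ∫ t in (0 : ℝ)..(2 * Real.pi), q t =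
      (starRingEnd ℂ) (∫ t in (0 : ℝ)..(2 * Real.pi), p t) :=
    integral_pole_eq_conj hL hloop hzb hzp hw hwp
  have hzc := hloop.smooth.continuous
  have hdc := hloop.smooth.continuous_deriv le_rfl
  have hwc : Continuous fun t => z t * sheetRoot (StdExample.lam θ) (z t) :=
    hzc.mul ((sheetRoot_differentiableOn hL).continuousOn.comp_continuous hzc hloop.mem)
  have hw0 : ∀ t, z t * sheetRoot (StdExample.lam θ) (z t) ≠ 0 := fun t =>
    mul_sheetRoot_ne_zero hL (hloop.mem t)
  have hpc : Continuous p :=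
    (((continuous_const.sub (continuous_const.mul hzc)).div hwc hw0).div
      (hzc.add continuous_const) hzb).mul hdc
  have hqc : Continuous q :=
    (((hzc.add continuous_const).div (continuous_const.sub (continuous_const.mul hzc)) hzp).div
      hwc hw0).mul hdc
  have e1 : ∀ t, 1 / StdExample.gauss α β (γ t) * StdExample.dhCoeff θ (γ t) * deriv z t =
      κ * p t := by
    intro t
    have hzt : (γ t).1 = z t := rfl
    have a1 : z t + b ≠ 0 := hzb t
    have a2 : 1 - (starRingEnd ℂ) b * z t ≠ 0 := hzp t
    have a3 := hw0 t
    rw [StdExample.gauss, StdExample.dhCoeff, hsnd, hnum, hden, hp, hκ, hzt]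
    simp only [periodNum]
    field_simp
  have e2 : ∀ t, StdExample.gauss α β (γ t) * StdExample.dhCoeff θ (γ t) * deriv z t =
      (starRingEnd ℂ) κ * q t := by
    intro t
    have hzt : (γ t).1 = z t := rfl
    have a1 : z t + b ≠ 0 := hzb t
    have a2 : 1 - (starRingEnd ℂ) b * z t ≠ 0 := hzp t
    have a3 := hw0 t
    rw [StdExample.gauss, StdExample.dhCoeff, hsnd, hnum, hden, hq, hκc, ← inv_I, hzt]
    field_simp
  have hAc : (starRingEnd ℂ) A = (starRingEnd ℂ) κ * ∫ t in (0 : ℝ)..(2 * Real.pi), q t := by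
    rw [hA, map_mul, hqp, gaussPeriod]
  have hcomb : ∀ u v : ℂ, ∫ t in (0 : ℝ)..(2 * Real.pi),
      (u * (κ * p t) + v * ((starRingEnd ℂ) κ * q t)) = u * A + v * (starRingEnd ℂ) A := by
    intro u v
    have c1 : Continuous fun t => u * (κ * p t) :=
      continuous_const.mul (continuous_const.mul hpc)
    have c2 : Continuous fun t => v * ((starRingEnd ℂ) κ * q t) :=
      continuous_const.mul (continuous_const.mul hqc)
    rw [intervalIntegral.integral_add (c1.intervalIntegrable _ _) (c2.intervalIntegrable _ _)]
    simp only [intervalIntegral.integral_const_mul]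
    rw [hAc, hA, gaussPeriod]
  have f0 : StdExample.weierstrassIntegral θ α β γ 0 =
      1 / 2 * A + -(1 / 2) * (starRingEnd ℂ) A := by
    rw [← hcomb, StdExample.weierstrassIntegral]
    refine intervalIntegral.integral_congr fun t _ => ?_
    simp only [← e1, ← e2]
    change 1 / 2 * (1 / StdExample.gauss α β (γ t) - StdExample.gauss α β (γ t)) *
      StdExample.dhCoeff θ (γ t) * deriv z t = _
    ring
  have f1 : StdExample.weierstrassIntegral θ α β γ 1 =
      I / 2 * A + I / 2 * (starRingEnd ℂ) A := by
    rw [← hcomb, StdExample.weierstrassIntegral]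
    refine intervalIntegral.integral_congr fun t _ => ?_
    simp only [← e1, ← e2]
    change I / 2 * (1 / StdExample.gauss α β (γ t) + StdExample.gauss α β (γ t)) *
      StdExample.dhCoeff θ (γ t) * deriv z t = _
    ring
  have f2 : StdExample.weierstrassIntegral θ α β γ 2 = 2 * Real.pi * I := by
    rw [← integral_height hθ hloop, StdExample.weierstrassIntegral]
    refine intervalIntegral.integral_congr fun t _ => ?_
    change StdExample.dhCoeff θ (γ t) * deriv z t = _
    rw [StdExample.dhCoeff, hsnd]
  have g0 : (StdExample.weierstrassIntegral θ α β γ 0).im = A.im := by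
    rw [f0]
    simp
    ring
  have g1 : (StdExample.weierstrassIntegral θ α β γ 1).im = A.re := by
    rw [f1, ← mul_add, add_conj]
    simp
  have g2 : (StdExample.weierstrassIntegral θ α β γ 2).im = 2 * Real.pi := by
    rw [f2]
    simp
  funext k
  fin_cases k
  · exact g0
  · exact g1
  · exact g2

end

theorem lemma2p1 (θ α β : ℝ)
    (hθ : θ ∈ Set.Ioo (0 : ℝ) (Real.pi / 2))
    (hα : α ∈ Set.Icc (0 : ℝ) (Real.pi / 2))
    (hβ : β ∈ Set.Icc (0 : ℝ) (Real.pi / 2))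
    (hne : (α, β) ≠ (0, θ)) :
    (∃ γ : ℝ → ℂ × ℂ, StdExample.IsGammaTwo θ α β γ) ∧
    ∀ γ : ℝ → ℂ × ℂ, StdExample.IsGammaTwo θ α β γ →
      (StdExample.flux θ α β γ = ![0, 0, 2 * Real.pi] ↔ α = 0 ∧ β = 0) := by
  have hL := one_lt_lam hθ
  have hC := cos_mul_cos_nonneg hα hβ
  refine ⟨exists_isGammaTwo hL hC, fun γ hγ => ?_⟩
  obtain ⟨κ, hκ, z, hz, hzb, hw, hflux⟩ := exists_flux_eq hθ hC hγ
  rw [hflux, ← zeroParam_eq_zero_iff hα hβ]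
  constructor
  · intro h
    by_contra hb0
    have hA := mul_ne_zero hκ (period_ne_zero hL (norm_zeroParam_le hC) hb0 hz hzb hw)
    exact hA (Complex.ext (congrFun h 1) (congrFun h 0))
  · intro hb0
    rw [hb0, gaussPeriod, period_eq_zero hL hz]
    simp
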